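/- Let $l_1,l_2\in\mathbb N_0$ be degrees, let $k_i,n_i\in\{-l_i,\dots,l_i\}$ ($i=1,2$) be integer orders, let $m\in\mathbb N_0$, and let $\theta_p\in[0,\pi]$, $\phi_p,\chi_p\in\mathbb R$ for $p=1,\dots,m$. For $l\in\mathbb N_0$ and integers $|k|,|n|\le l$ let $$\mathrm Y_l^k(\theta,\phi)=\sqrt{\tfrac{2l+1}{4\pi}\tfrac{(l-k)!}{(l+k)!}}\,P_l^k(\cos\theta)\,e^{\mathrm i k\phi},\qquad P_l^k(x)=\frac{(-1)^k}{2^l l!}(1-x^2)^{k/2}\frac{\mathrm d^{k+l}}{\mathrm dx^{k+l}}(x^2-1)^l$$ be the spherical harmonics (at $x=\pm1$ and $k<0$, $P_l^k$ is defined by its limit $0$), and let $$\mathrm D_l^{k,n}(\theta,\phi,\chi)=\sqrt{\tfrac{2l+1}{8\pi^2}}\,e^{-\mathrm ik\phi}\,\mathrm d_l^{k,n}(\cos\theta)\,e^{-\mathrm in\chi},\qquad \mathrm d_l^{k,n}(\cos\theta)=\omega\sqrt{\gamma}\,\sin^{\xi}\!\big(\tfrac\theta2\big)\cos^{\lambda}\!\big(\tfrac\theta2\big)P_\alpha^{(\xi,\lambda)}(\cos\theta)$$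 be the Wigner D-functions, where $\xi=|k-n|$, $\lambda=|k+n|$, $\alpha=l-\frac{\xi+\lambda}2$, $\gamma=\frac{\alpha!(\alpha+\xi+\lambda)!}{(\alpha+\xi)!(\alpha+\lambda)!}$, $\omega=1$ if $n\ge k$ and $\omega=(-1)^{n-k}$ if $n<k$, and $P_\alpha^{(\xi,\lambda)}$ is the Jacobi polynomial $$P_\alpha^{(\xi,\lambda)}(x)=\frac{(-1)^\alpha}{2^\alpha\alpha!}(1-x)^{-\xi}(1+x)^{-\lambda}\frac{\mathrm d^\alpha}{\mathrm dx^\alpha}\Big((1-x)^\xi(1+x)^\lambda(1-x^2)^\alpha\Big).$$ Let $\begin{pmatrix} l_1&l_2&l_3\\ m_1&m_2&m_3\end{pmatrix}\in\mathbb R$ denote the Wigner 3j symbol: it is $0$ unless $|m_i|\le l_i$ for $i=1,2,3$, $m_1+m_2+m_3=0$ and $|l_1-l_2|\le l_3\le l_1+l_2$, and in that case it equals $$(-1)^{l_1-l_2-m_3}\sqrt{\tfrac{(l_1+l_2-l_3)!(l_1-l_2+l_3)!(-l_1+l_2+l_3)!}{(l_1+l_2+l_3+1)!}}\sqrt{\textstyle\prod_{i=1}^3(l_i+m_i)!(l_i-m_i)!}\;\sum_t\frac{(-1)^t}{t!\,(l_3-l_2+t+m_1)!\,(l_3-l_1+t-m_2)!\,(l_1+l_2-l_3-t)!\,(l_1-t-m_1)!\,(l_2-t+m_2)!},$$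 the sum being over all integers $t$ for which all factorials have nonnegative arguments. Put $\hat k=k_2-k_1$ and $\hat n=n_2-n_1$. Then $$\sum_{p=1}^m\overline{\mathrm D_{l_1}^{k_1,n_1}(\theta_p,\phi_p,\chi_p)}\,\mathrm D_{l_2}^{k_2,n_2}(\theta_p,\phi_p,\chi_p)=(-1)^{k_2+n_2}\sum_{\hat l=|l_2-l_1|}^{l_1+l_2}\sqrt{\tfrac{(2l_1+1)(2l_2+1)(2\hat l+1)}{8\pi^2}}\begin{pmatrix} l_1&l_2&\hat l\\ -n_1&n_2&-\hat n\end{pmatrix}\begin{pmatrix} l_1&l_2&\hat l\\ -k_1&k_2&-\hat k\end{pmatrix}\Big(\sum_{p=1}^m\mathrm D_{\hat l}^{\hat k,\hat n}(\theta_p,\phi_p,\chi_p)\Big)$$ and $$\sum_{p=1}^m\overline{\mathrm Y_{l_1}^{k_1}(\theta_p,\phi_p)}\,\mathrm Y_{l_2}^{k_2}(\theta_p,\phi_p)=\sum_{p=1}^m(-1)^{k_1}\mathrm Y_{l_1}^{-k_1}(\theta_p,\phi_p)\,\mathrm Y_{l_2}^{k_2}(\theta_p,\phi_p)$$ $$=(-1)^{k_2}\sum_{\hat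 l=|l_1-l_2|}^{l_1+l_2}\sqrt{\tfrac{(2l_1+1)(2l_2+1)(2\hat l+1)}{4\pi}}\begin{pmatrix} l_1&l_2&\hat l\\ 0&0&0\end{pmatrix}\begin{pmatrix} l_1&l_2&\hat l\\ -k_1&k_2&-\hat k\end{pmatrix}\Big(\sum_{p=1}^m\mathrm Y_{\hat l}^{\hat k}(\theta_p,\phi_p)\Big).$$ Terms with $\hat l<|\hat k|$ or, in the first identity, $\hat l<|\hat n|$, in which $\mathrm D_{\hat l}^{\hat k,\hat n}$ or $\mathrm Y_{\hat l}^{\hat k}$ is not defined, have a vanishing 3j symbol and are read as $0$. -/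

import Mathlib

open Polynomial

noncomputable section

/-- Associated Legendre function `P_l^k`, for `-l ≤ k ≤ l`, on `[-1, 1]`:
`(-1)^k / (2^l l!) * (1 - x^2)^(k/2) * (d/dx)^(k+l) (x^2 - 1)^l`.
For `k < 0` and `x = ±1` the derivative vanishes to order `-k` and the formula below gives `0`,
which is the limit at the end point. -/
def assocLegendre (l : ℕ) (k : ℤ) (x : ℝ) : ℝ :=
  (-1 : ℝ) ^ k / (2 ^ l * (l.factorial : ℝ)) * (1 - x ^ 2) ^ ((k : ℝ) / 2) *
    (derivative^[(k + l).toNat] ((X ^ 2 - 1 : ℝ[X]) ^ l)).eval x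

/-- Spherical harmonic `Y_l^k(θ, φ)` of degree `l` and order `k`, `-l ≤ k ≤ l`. -/
def sphericalHarmonic (l : ℕ) (k : ℤ) (θ φ : ℝ) : ℂ :=
  ((Real.sqrt ((2 * l + 1) / (4 * Real.pi) *
      ((((l : ℤ) - k).toNat.factorial : ℝ) / (((l : ℤ) + k).toNat.factorial : ℝ))) *
    assocLegendre l k (Real.cos θ) : ℝ) : ℂ) * Complex.exp (Complex.I * k * φ)

/-- Jacobi polynomial `P_α^{(ξ,lam)}` by Rodrigues' formula
`(-1)^α / (2^α α!) * (1-x)^(-ξ) * (1+x)^(-lam) * (d/dx)^α ((1-x)^ξ (1+x)^lam (1-x^2)^α)`.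
The quotient is an exact division of polynomials, see `jacobiPoly_rodrigues`. -/
def jacobiPoly (α ξ lam : ℕ) : ℝ[X] :=
  C ((-1 : ℝ) ^ α / (2 ^ α * (α.factorial : ℝ))) *
    (derivative^[α] ((1 - X) ^ ξ * (1 + X) ^ lam * (1 - X ^ 2) ^ α) /
      ((1 - X) ^ ξ * (1 + X) ^ lam))

/-- The division in the definition of the Jacobi polynomials is exact. -/
theorem jacobiPoly_rodrigues (α ξ lam : ℕ) :
    (1 - X) ^ ξ * (1 + X) ^ lam * jacobiPoly α ξ lam =
      C ((-1 : ℝ) ^ α / (2 ^ α * (α.factorial : ℝ))) *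
        derivative^[α] ((1 - X) ^ ξ * (1 + X) ^ lam * (1 - X ^ 2) ^ α) := by
  have hd : ((1 - X) ^ ξ * (1 + X) ^ lam : ℝ[X]) ∣
      derivative^[α] ((1 - X) ^ ξ * (1 + X) ^ lam * (1 - X ^ 2) ^ α) := by
    have hfac : ((1 - X) ^ ξ * (1 + X) ^ lam * (1 - X ^ 2) ^ α : ℝ[X]) =
        (1 - X) ^ (ξ + α) * (1 + X) ^ (lam + α) := by
      have h : (1 - X ^ 2 : ℝ[X]) = (1 - X) * (1 + X) := by ring
      rw [h, mul_pow]
      ring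
    rw [hfac]
    have hco : IsCoprime (1 - X : ℝ[X]) (1 + X) := by
      refine ⟨C (1 / 2), C (1 / 2), ?_⟩
      rw [← mul_add]
      have h : (1 - X + (1 + X) : ℝ[X]) = C 2 := by
        rw [show (C 2 : ℝ[X]) = 2 from rfl]
        ring
      rw [h, ← C_mul]
      norm_num
    refine IsCoprime.mul_dvd hco.pow ?_ ?_
    · have h := pow_sub_dvd_iterate_derivative_of_pow_dvd α
        (dvd_mul_right ((1 - X : ℝ[X]) ^ (ξ + α)) ((1 + X) ^ (lam + α)))
      simpa using h
    · have h := pow_sub_dvd_iterate_derivative_of_pow_dvd α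
        (dvd_mul_left ((1 + X : ℝ[X]) ^ (lam + α)) ((1 - X) ^ (ξ + α)))
      simpa using h
  unfold jacobiPoly
  rw [mul_left_comm, EuclideanDomain.mul_div_cancel' _ hd]
  intro h0
  have h1 := congrArg (Polynomial.eval 0) h0
  simp at h1

/-- Wigner d-function `d_l^{k,n}(cos θ)`, for `-l ≤ k, n ≤ l` and `θ ∈ [0, π]`.
Here `ξ = |k - n|`, `lam = |k + n|`, `α = l - (ξ + lam) / 2 = l - max |k| |n|`. -/
def wignerSmallD (l : ℕ) (k n : ℤ) (θ : ℝ) : ℝ :=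
  let ξ : ℕ := (k - n).natAbs
  let lam : ℕ := (k + n).natAbs
  let α : ℕ := l - (ξ + lam) / 2
  let γ : ℝ := ((α.factorial : ℝ) * ((α + ξ + lam).factorial : ℝ)) /
    (((α + ξ).factorial : ℝ) * ((α + lam).factorial : ℝ))
  let ω : ℝ := if k ≤ n then 1 else (-1) ^ (n - k)
  ω * Real.sqrt γ * Real.sin (θ / 2) ^ ξ * Real.cos (θ / 2) ^ lam *
    (jacobiPoly α ξ lam).eval (Real.cos θ)

/-- Wigner D-function `D_l^{k,n}(θ, φ, χ)` of degree `l` and orders `-l ≤ k, n ≤ l`,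
normalized to unit norm on the rotation group with `sin θ dθ dφ dχ`. -/
def wignerD (l : ℕ) (k n : ℤ) (θ φ χ : ℝ) : ℂ :=
  (Real.sqrt ((2 * l + 1) / (8 * Real.pi ^ 2)) : ℂ) * Complex.exp (-(Complex.I * k * φ)) *
    (wignerSmallD l k n θ : ℂ) * Complex.exp (-(Complex.I * n * χ))

/-- Wigner 3j symbol with first row `l₁, l₂, l₃` and second row `k₁, k₂, k₃` (all integers), by
Racah's formula; the sum is over all `t` for which every factorial has a nonnegative argument.
The symbol is `0` unless `|kᵢ| ≤ lᵢ`, `k₁ + k₂ + k₃ = 0` and `|l₁ - l₂| ≤ l₃ ≤ l₁ + l₂`. -/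
def wigner3j (l₁ l₂ l₃ : ℕ) (k₁ k₂ k₃ : ℤ) : ℝ :=
  if |k₁| ≤ l₁ ∧ |k₂| ≤ l₂ ∧ |k₃| ≤ l₃ ∧ k₁ + k₂ + k₃ = 0 ∧
      |(l₁ : ℤ) - l₂| ≤ l₃ ∧ l₃ ≤ l₁ + l₂ then
    (-1 : ℝ) ^ ((l₁ : ℤ) - l₂ - k₃) *
    Real.sqrt ((((l₁ + l₂ - l₃).factorial : ℝ) * ((l₁ + l₃ - l₂).factorial : ℝ) *
      ((l₂ + l₃ - l₁).factorial : ℝ)) / ((l₁ + l₂ + l₃ + 1).factorial : ℝ)) *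
    Real.sqrt ((((l₁ : ℤ) + k₁).toNat.factorial : ℝ) * (((l₁ : ℤ) - k₁).toNat.factorial : ℝ) *
      (((l₂ : ℤ) + k₂).toNat.factorial : ℝ) * (((l₂ : ℤ) - k₂).toNat.factorial : ℝ) *
      (((l₃ : ℤ) + k₃).toNat.factorial : ℝ) * (((l₃ : ℤ) - k₃).toNat.factorial : ℝ)) *
    ∑ t ∈ (Finset.range (l₁ + l₂ - l₃ + 1)).filter (fun t : ℕ =>
        0 ≤ (l₃ : ℤ) - l₂ + t + k₁ ∧ 0 ≤ (l₃ : ℤ) - l₁ + t - k₂ ∧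
        0 ≤ (l₁ : ℤ) - t - k₁ ∧ 0 ≤ (l₂ : ℤ) - t + k₂),
      (-1 : ℝ) ^ t /
        ((t.factorial : ℝ) * (((l₃ : ℤ) - l₂ + t + k₁).toNat.factorial : ℝ) *
          (((l₃ : ℤ) - l₁ + t - k₂).toNat.factorial : ℝ) *
          ((l₁ + l₂ - l₃ - t).factorial : ℝ) *
          (((l₁ : ℤ) - t - k₁).toNat.factorial : ℝ) *
          (((l₂ : ℤ) - t + k₂).toNat.factorial : ℝ))
  else 0

end

/-!
The substitution by a `2 × 2` matrix on binary forms of degree `q + r` has the coefficients of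
`(a X + b) ^ q * (c X + d) ^ r` as its matrix. The product of two of these matrix coefficients is
expanded by a Clebsch–Gordan series: one first writes `d ^ m * a ^ n` as a sum of powers of the
determinant times the invariant kernels of the forms of degree `m + n - 2 * p` (induction on `m`,
with weights obeying a Pascal-type recurrence), then substitutes linear forms for the entries and
compares coefficients twice, once for each index of the matrix. The coefficients appearing are
Racah's single sums, so after normalizing the monomials they become the two 3j symbols.

For the rotation by `θ / 2` the normalized matrix coefficient is the Wigner d-function: a Taylor
expansion turns Rodrigues' formulas for the Jacobi polynomials and the Legendre functions into
coefficients of a product of two powers of linear polynomials. The powers of `sin` and `cos` in the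
comparison can be cancelled where `sin θ ≠ 0`, and by continuity this suffices for the Jacobi
polynomials. The spherical harmonics are, up to normalization, the D-functions whose first order
is `0`.
-/

section LinearForms

open Finset.HasAntidiagonal (antidiagonal)
open scoped Polynomial.Bivariate

/-- The coefficient of `X ^ i` in `(a X + b) ^ q * (c X + d) ^ r`. For `q + r = N` fixed these
numbers are the matrix of the substitution by `!![a, b; c, d]` on binary forms of degree `N`. -/
noncomputable def linPowCoeff {R : Type*} [CommRing R] (a b c d : R) (q r i : ℕ) : R :=
  ((C a * X + C b) ^ q * (C c * X + C d) ^ r).coeff i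

variable {R : Type*} [CommRing R]

lemma map_linPowCoeff {S : Type*} [CommRing S] (f : R →+* S) (a b c d : R) (q r i : ℕ) :
    f (linPowCoeff a b c d q r i) = linPowCoeff (f a) (f b) (f c) (f d) q r i := by
  simp [linPowCoeff, ← coeff_map]

lemma coeff_linear_pow (a b : R) (n i : ℕ) :
    ((C a * X + C b) ^ n).coeff i = n.choose i * a ^ i * b ^ (n - i) := by
  have hcomp : (C a * X + C b) ^ n = ((X + C b) ^ n).comp (C a * X) := by simp
  rw [hcomp, comp_C_mul_X_coeff, coeff_X_add_C_pow]
  ring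

lemma linPowCoeff_eq_sum (a b c d : R) (q r i : ℕ) :
    linPowCoeff a b c d q r i = ∑ x ∈ antidiagonal i,
      (q.choose x.1 * a ^ x.1 * b ^ (q - x.1)) * (r.choose x.2 * c ^ x.2 * d ^ (r - x.2)) := by
  simp only [linPowCoeff, coeff_mul, coeff_linear_pow]

lemma natDegree_linear_pow_le (a b : R) (n : ℕ) : ((C a * X + C b) ^ n).natDegree ≤ n := by
  simpa using natDegree_pow_le_of_le n (natDegree_linear_le (a := a) (b := b))

lemma sum_antidiagonal_linPowCoeff_smul {A : Type*} [CommRing A] [Algebra R A] (a b c d : R)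
    (q r : ℕ) (z w : A) :
    ∑ x ∈ antidiagonal (q + r), linPowCoeff a b c d q r x.1 • (z ^ x.1 * w ^ x.2) =
      (a • z + b • w) ^ q * (c • z + d • w) ^ r := by
  have hpow (a b : R) (n : ℕ) : MvPolynomial.aeval ![z, w] (((C a * X + C b) ^ n).homogenize n) =
      (a • z + b • w) ^ n := by
    have hlin : (C a * X + C b).homogenize 1 =
        MvPolynomial.C a * MvPolynomial.X 0 + MvPolynomial.C b * MvPolynomial.X 1 := by
      simp
    have h := homogenize_finsetProd (s := Finset.range n) (p := fun _ => C a * X + C b)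
      (n := fun _ => 1) fun _ _ => natDegree_linear_le
    simp only [Finset.prod_const, Finset.card_range, Finset.sum_const, smul_eq_mul, mul_one] at h
    rw [h, hlin]
    simp [Algebra.smul_def]
  rw [← hpow, ← hpow, ← map_mul, ← homogenize_mul _ _ (natDegree_linear_pow_le a b q)
    (natDegree_linear_pow_le c d r), homogenize, map_sum]
  simp [linPowCoeff, MvPolynomial.aeval_monomial, Algebra.smul_def, Finsupp.prod_fintype]

lemma sum_linPowCoeff_mul_linPowCoeff (a b c d a' b' c' d' : R) (q r j : ℕ) :
    ∑ x ∈ antidiagonal (q + r),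
        linPowCoeff a b c d q r x.1 * linPowCoeff a' b' c' d' x.1 x.2 j =
      linPowCoeff (a * a' + b * c') (a * b' + b * d') (c * a' + d * c') (c * b' + d * d')
        q r j := by
  have h := congrArg (coeff · j)
    (sum_antidiagonal_linPowCoeff_smul a b c d q r (C a' * X + C b') (C c' * X + C d'))
  simp only [finsetSum_coeff, coeff_smul, smul_eq_mul] at h
  refine h.trans ?_
  rw [linPowCoeff]
  congr 3 <;> simp only [smul_eq_C_mul, C_add, C_mul] <;> ring

lemma coeff_coeff_swap (p : R[X][Y]) (i j : ℕ) :
    ((Polynomial.Bivariate.swap p).coeff i).coeff j = (p.coeff j).coeff i := by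
  induction p using Polynomial.induction_on' with
  | add p q hp hq => simp [hp, hq]
  | monomial n f =>
    induction f using Polynomial.induction_on' with
    | add f g hf hg => simp only [map_add, coeff_add, hf, hg]
    | monomial m r =>
      simp only [Bivariate.swap_monomial_monomial, coeff_monomial]
      split_ifs <;> simp_all [coeff_monomial]

lemma choose_mul_linPowCoeff (a b c d : R) {n i j : ℕ} :
    n.choose i * linPowCoeff a b c d i (n - i) j =
      n.choose j * linPowCoeff a c b d j (n - j) i := by
  have hcoeff (a b c d : R) (i j : ℕ) :
      (((C (C a * X + C b) * Y + C (C c * X + C d)) ^ n : R[X][Y]).coeff i).coeff j =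
        n.choose i * linPowCoeff a b c d i (n - i) j := by
    rw [coeff_linear_pow, mul_assoc, ← C_eq_natCast, coeff_C_mul, linPowCoeff]
  rw [← hcoeff, ← hcoeff, ← coeff_coeff_swap]
  congr 2
  simp only [map_pow, map_add, map_mul, Bivariate.swap_X, Bivariate.swap_Y, Bivariate.swap_C_C]
  ring

lemma linPowCoeff_zero_right (a b c d : R) (q : ℕ) : linPowCoeff a b c d q 0 q = a ^ q := by
  simp [linPowCoeff, coeff_linear_pow]

lemma linPowCoeff_succ_right (a b c d : R) (q r i : ℕ) :
    linPowCoeff a b c d q (r + 1) (i + 1) =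
      c * linPowCoeff a b c d q r i + d * linPowCoeff a b c d q r (i + 1) := by
  have hsplit : (C a * X + C b) ^ q * (C c * X + C d) ^ (r + 1) =
      C c * ((C a * X + C b) ^ q * (C c * X + C d) ^ r) * X +
        C d * ((C a * X + C b) ^ q * (C c * X + C d) ^ r) := by ring
  simp only [linPowCoeff, hsplit, coeff_add, coeff_mul_X, coeff_C_mul]

lemma sub_mul_linPowCoeff (a b c d : R) (q r i : ℕ) :
    (a * d - b * c) * linPowCoeff a b c d q r i =
      a * linPowCoeff a b c d q (r + 1) i - c * linPowCoeff a b c d (q + 1) r i := by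
  simp only [linPowCoeff, ← coeff_C_mul, ← coeff_sub]
  congr 1
  simp only [C_sub, C_mul]
  ring

lemma succ_mul_linPowCoeff_succ (a b c d : R) (q r i : ℕ) :
    (i + 1) * linPowCoeff a b c d (q + 1) (r + 1) (i + 1) =
      (q + 1) * a * linPowCoeff a b c d q (r + 1) i +
        (r + 1) * c * linPowCoeff a b c d (q + 1) r i := by
  have h := coeff_derivative ((C a * X + C b) ^ (q + 1) * (C c * X + C d) ^ (r + 1)) i
  rw [linPowCoeff, mul_comm, ← h, derivative_mul, derivative_pow_succ, derivative_pow_succ]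
  simp only [linPowCoeff, ← coeff_C_mul, ← coeff_add]
  congr 1
  simp only [map_add, map_natCast, map_one, derivative_mul, derivative_C,
    zero_mul, derivative_X, mul_one, zero_add, add_zero, map_mul]
  ring

lemma linPowCoeff_central_recurrence (a b c d : R) (q r : ℕ) :
    (q + r + 2) * (d * linPowCoeff a b c d (q + 1) r (q + 1)) =
      (r + 1) * linPowCoeff a b c d (q + 1) (r + 1) (q + 1) +
        (q + 1) * ((a * d - b * c) * linPowCoeff a b c d q r q) := by
  rw [sub_mul_linPowCoeff]
  linear_combination succ_mul_linPowCoeff_succ a b c d q r q -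
    (q + r + 2) * linPowCoeff_succ_right a b c d (q + 1) r q

lemma linPowCoeff_row_mul (t u a b c d : R) (q r i : ℕ) :
    linPowCoeff (t * a) (t * b) (u * c) (u * d) q r i =
      t ^ q * u ^ r * linPowCoeff a b c d q r i := by
  have hrow : (C (t * a) * X + C (t * b)) ^ q * (C (u * c) * X + C (u * d)) ^ r =
      C (t ^ q * u ^ r) * ((C a * X + C b) ^ q * (C c * X + C d) ^ r) := by
    simp only [C_mul, C_pow]
    rw [mul_assoc (C t), mul_assoc (C u), ← mul_add, ← mul_add, mul_pow, mul_pow]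
    ring
  rw [linPowCoeff, hrow, coeff_C_mul, linPowCoeff]

lemma linPowCoeff_mul_column (t a b c d : R) (q r i : ℕ) :
    linPowCoeff (a * t) b (c * t) d q r i = t ^ i * linPowCoeff a b c d q r i := by
  rw [linPowCoeff, linPowCoeff, mul_comm (t ^ i), ← comp_C_mul_X_coeff]
  simp [mul_assoc]

lemma linPowCoeff_swap_rows (a b c d : R) (q r i : ℕ) :
    linPowCoeff c d a b r q i = linPowCoeff a b c d q r i := by
  rw [linPowCoeff, mul_comm, linPowCoeff]

lemma linPowCoeff_swap_columns (a b c d : R) {q r i : ℕ}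
    (hi : i ≤ q + r) : linPowCoeff b a d c q r (q + r - i) = linPowCoeff a b c d q r i := by
  have hreflect (a b : R) (n : ℕ) : reflect n ((C a * X + C b) ^ n) = (C b * X + C a) ^ n := by
    ext i
    rw [coeff_reflect, coeff_linear_pow, coeff_linear_pow]
    rcases le_or_gt i n with hin | hin
    · rw [revAt_le hin, Nat.choose_symm hin, Nat.sub_sub_self hin]
      ring
    · rw [revAt_eq_self_of_lt hin]
      simp [Nat.choose_eq_zero_of_lt hin]
  rw [linPowCoeff, ← hreflect a b, ← hreflect c d,
    ← reflect_mul _ _ (natDegree_linear_pow_le a b q) (natDegree_linear_pow_le c d r),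
    coeff_reflect, revAt_le (Nat.sub_le _ _), Nat.sub_sub_self hi, linPowCoeff]

end LinearForms

section ClebschGordan

/-- The weight of the representation of highest weight `m + n - 2 * p` in the Clebsch–Gordan
series of binary forms of degrees `m` and `n`. -/
def cgWeight (m n p : ℕ) : ℚ :=
  m.choose p * n.choose p / (m + n + 1 - p).choose p

lemma cgWeight_eq_zero_of_lt {m n p : ℕ} (h : m < p ∨ n < p) : cgWeight m n p = 0 := by
  rcases h with h | h <;> simp [cgWeight, Nat.choose_eq_zero_of_lt h]

lemma cgWeight_zero_right (m n : ℕ) : cgWeight m n 0 = 1 := by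
  simp [cgWeight]

lemma cgWeight_succ_succ {m p : ℕ} (n : ℕ) (hp : p ≤ m) :
    cgWeight (m + 1) n (p + 1) = cgWeight m n (p + 1) +
      cgWeight m n p * (((n : ℚ) - p) ^ 2 / ((m + n - 2 * p) * (m + n - 2 * p + 1))) := by
  rcases lt_or_ge p n with hn | hn
  · obtain ⟨d, rfl⟩ := Nat.exists_eq_add_of_le hp
    obtain ⟨e, rfl⟩ : ∃ e, n = p + (e + 1) := ⟨n - p - 1, by lia⟩
    have hright (k : ℕ) : ((p + k).choose (p + 1) : ℚ) = (p + k).choose p * k / (p + 1) := by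
      have h := Nat.choose_succ_right_eq (p + k) p
      rw [Nat.add_sub_cancel_left] at h
      rw [eq_div_iff (by positivity)]
      exact_mod_cast h
    have hm : ((p + d + 1).choose (p + 1) : ℚ) = (p + d + 1) * (p + d).choose p / (p + 1) := by
      rw [eq_div_iff (by positivity)]
      exact_mod_cast (Nat.add_one_mul_choose_eq (p + d) p).symm
    have hD : ((p + (d + e + 1)).choose (p + 1) : ℚ) =
        (p + (d + e + 2)).choose (p + 1) * (d + e + 1) / (p + d + e + 2) := by
      have h : (p + (d + e + 1)).choose (p + 1) * (p + d + e + 2) =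
          (p + (d + e + 2)).choose (p + 1) * (d + e + 1) := by
        convert Nat.choose_mul_succ_eq (p + (d + e + 1)) (p + 1) using 2 <;> lia
      rw [eq_div_iff (by positivity)]
      exact_mod_cast h
    have h0 : ((p + (d + e + 2)).choose p : ℚ) ≠ 0 := by
      exact_mod_cast (Nat.choose_pos (by lia)).ne'
    simp only [cgWeight, show p + d + (p + (e + 1)) + 1 - p = p + (d + e + 2) by lia,
      show p + d + 1 + (p + (e + 1)) + 1 - (p + 1) = p + (d + e + 2) by lia,
      show p + d + (p + (e + 1)) + 1 - (p + 1) = p + (d + e + 1) by lia]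
    rw [hm, hD, hright d, hright (e + 1), hright (d + e + 2)]
    push_cast
    rw [show (p + d + (p + (e + 1)) - 2 * p : ℚ) = d + e + 1 by ring, add_sub_cancel_left]
    field_simp
    ring
  · rw [cgWeight_eq_zero_of_lt (Or.inr (by lia)), cgWeight_eq_zero_of_lt (Or.inr (by lia))]
    rcases hn.eq_or_lt with rfl | hn
    · simp
    · simp [cgWeight_eq_zero_of_lt (Or.inr hn)]

variable {K : Type*} [Field K]

/-- The coefficient of `X ^ q` in `(a X + b) ^ q * (c X + d) ^ r`, normalized so as to be `1` for
the identity matrix: the invariant kernel of the representation of `GL₂` on binary forms. -/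
noncomputable def centralCoeff (a b c d : K) (q r : ℕ) : K :=
  linPowCoeff a b c d q r q / (q + r).choose q

variable [CharZero K]

lemma mul_centralCoeff (a b c d : K) (q r : ℕ) :
    d * centralCoeff a b c d q r = centralCoeff a b c d q (r + 1) +
      q ^ 2 / ((q + r) * (q + r + 1)) *
        ((a * d - b * c) * centralCoeff a b c d (q - 1) r) := by
  cases q with
  | zero => simp [centralCoeff, linPowCoeff_eq_sum, pow_succ']
  | succ q =>
    have hrec := linPowCoeff_central_recurrence a b c d q r
    have h1 : ((q + r + 1).choose (q + 1) : K) * (q + 1) = (q + r + 1) * (q + r).choose q := by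
      exact_mod_cast (Nat.add_one_mul_choose_eq (q + r) q).symm
    have h2 : ((q + r + 2).choose (q + 1) : K) * (r + 1) =
        (q + r + 1).choose (q + 1) * (q + r + 2) := by
      have := Nat.choose_mul_succ_eq (q + r + 1) (q + 1)
      rw [show q + r + 1 + 1 - (q + 1) = r + 1 by lia] at this
      exact_mod_cast this.symm
    have h0 : ((q + r).choose q : K) ≠ 0 := by
      exact_mod_cast (Nat.choose_pos (Nat.le_add_right q r)).ne'
    have hq : (q + 1 : K) ≠ 0 := Nat.cast_add_one_ne_zero q
    have hr : (r + 1 : K) ≠ 0 := Nat.cast_add_one_ne_zero r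
    have hqr : (q + r + 1 : K) ≠ 0 := by
      simpa using Nat.cast_add_one_ne_zero (R := K) (q + r)
    have hqr' : (q + r + 2 : K) ≠ 0 := by
      simpa [add_assoc, one_add_one_eq_two] using Nat.cast_add_one_ne_zero (R := K) (q + r + 1)
    rw [← eq_div_iff hq] at h1
    rw [h1, ← eq_div_iff hr] at h2
    simp only [centralCoeff, show q + 1 + r = q + r + 1 by lia,
      show q + 1 + (r + 1) = q + r + 2 by lia, h1, h2, Nat.add_sub_cancel]
    push_cast
    rw [show (q + 1 + r : K) = q + r + 1 by ring, show (q + r + 1 + 1 : K) = q + r + 2 by ring]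
    field_simp
    linear_combination hrec

lemma pow_mul_pow_eq_sum_cgWeight (a b c d : K) (m n : ℕ) :
    d ^ m * a ^ n = ∑ p ∈ Finset.range (m + 1),
      cgWeight m n p * ((a * d - b * c) ^ p * centralCoeff a b c d (n - p) (m - p)) := by
  induction m with
  | zero => simp [cgWeight_zero_right, centralCoeff, linPowCoeff_zero_right]
  | succ m ih =>
    have hstep (p : ℕ) (hp : p ∈ Finset.range (m + 1)) :
        d * (cgWeight m n p * ((a * d - b * c) ^ p * centralCoeff a b c d (n - p) (m - p))) =
          cgWeight m n p * ((a * d - b * c) ^ p * centralCoeff a b c d (n - p) (m + 1 - p)) +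
          (cgWeight m n p * (((n : ℚ) - p) ^ 2 / ((m + n - 2 * p) * (m + n - 2 * p + 1))) : ℚ) *
            ((a * d - b * c) ^ (p + 1) *
              centralCoeff a b c d (n - (p + 1)) (m + 1 - (p + 1))) := by
      rw [Finset.mem_range_succ_iff] at hp
      rcases le_or_gt p n with hn | hn
      · have h := mul_centralCoeff a b c d (n - p) (m - p)
        rw [← Nat.sub_add_comm hp, Nat.sub_sub] at h
        push_cast [hn, hp] at h ⊢
        rw [show (m + n - 2 * p : K) = n - p + (m - p) by ring]
        linear_combination (cgWeight m n p * (a * d - b * c) ^ p : K) * h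
      · simp [cgWeight_eq_zero_of_lt (Or.inr hn)]
    have hlast : (cgWeight m n (m + 1) : K) = 0 := by
      simp [cgWeight_eq_zero_of_lt (Or.inl (Nat.lt_succ_self m))]
    rw [pow_succ', mul_assoc, ih, Finset.mul_sum, Finset.sum_congr rfl hstep,
      Finset.sum_add_distrib, Finset.sum_range_succ' _ (m + 1), ← add_zero (Finset.sum _ _),
      ← zero_mul ((a * d - b * c) ^ (m + 1) * centralCoeff a b c d (n - (m + 1)) (m + 1 - (m + 1))),
      ← hlast, ← Finset.sum_range_succ (fun p => (cgWeight m n p : K) * ((a * d - b * c) ^ p *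
        centralCoeff a b c d (n - p) (m + 1 - p))), Finset.sum_range_succ', add_right_comm,
      ← Finset.sum_add_distrib]
    congr 1
    · refine Finset.sum_congr rfl fun p hp => ?_
      rw [cgWeight_succ_succ n (Finset.mem_range_succ_iff.mp hp)]
      push_cast
      ring
    · simp [cgWeight_zero_right]

end ClebschGordan

section Racah

open Finset.HasAntidiagonal (antidiagonal mem_antidiagonal)
open scoped Polynomial.Bivariate

variable {K : Type*} [Field K] [CharZero K]

lemma sum_linPowCoeff_mul_linPowCoeff_div_choose (u₀ u₁ x₀ x₁ v₀ v₁ y₀ y₁ : K) {q r i : ℕ}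
    (hi : i ≤ q + r) :
    ∑ k ∈ antidiagonal (q + r), linPowCoeff u₀ u₁ x₀ x₁ q r k.1 *
        (linPowCoeff v₀ v₁ y₀ y₁ i (q + r - i) k.1 / (q + r).choose k.1) =
      linPowCoeff (u₀ * v₀ + u₁ * v₁) (u₀ * y₀ + u₁ * y₁) (x₀ * v₀ + x₁ * v₁)
        (x₀ * y₀ + x₁ * y₁) q r i / (q + r).choose i := by
  rw [← sum_linPowCoeff_mul_linPowCoeff, Finset.sum_div]
  refine Finset.sum_congr rfl fun k hk => ?_
  rw [mem_antidiagonal] at hk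
  have hi' : ((q + r).choose i : K) ≠ 0 := by exact_mod_cast (Nat.choose_pos hi).ne'
  have hk' : ((q + r).choose k.1 : K) ≠ 0 := by exact_mod_cast (Nat.choose_pos (by lia)).ne'
  have h := choose_mul_linPowCoeff v₀ v₁ y₀ y₁ (n := q + r) (i := i) (j := k.1)
  rw [show q + r - k.1 = k.2 by lia] at h
  rw [mul_div_assoc, (div_eq_div_iff hk' hi').2]
  linear_combination h

lemma linear_pow_mul_linear_pow_eq_sum (x y₀ y₁ u v₀ v₁ : K) (m n : ℕ) :
    (y₀ * x + y₁) ^ m * (v₀ * u + v₁) ^ n =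
      ∑ p ∈ Finset.range (m + 1), ∑ k ∈ antidiagonal (n - p + (m - p)),
        cgWeight m n p * (y₀ * v₁ - y₁ * v₀) ^ p *
          (linPowCoeff v₀ v₁ y₀ y₁ (n - p) (m - p) k.1 / (n - p + (m - p)).choose k.1) *
          ((x - u) ^ p * linPowCoeff u 1 x 1 (n - p) (m - p) k.1) := by
  have h := pow_mul_pow_eq_sum_cgWeight (u * v₀ + 1 * v₁) (u * y₀ + 1 * y₁)
    (x * v₀ + 1 * v₁) (x * y₀ + 1 * y₁) m n
  simp only [centralCoeff, ← sum_linPowCoeff_mul_linPowCoeff_div_choose _ _ _ _ _ _ _ _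
    (Nat.le_add_right _ _), Nat.add_sub_cancel_left] at h
  have hdet : (u * v₀ + 1 * v₁) * (x * y₀ + 1 * y₁) - (u * y₀ + 1 * y₁) * (x * v₀ + 1 * v₁) =
      (y₀ * v₁ - y₁ * v₀) * (x - u) := by ring
  rw [hdet] at h
  convert h using 2
  · ring
  · ring
  · rw [Finset.mul_sum, Finset.mul_sum, mul_pow]
    exact Finset.sum_congr rfl fun k _ => by ring

/-- The coefficient of `x ^ i₁ * u ^ i₂` in `(x - u) ^ p * (u + 1) ^ q * (x + 1) ^ r`: up to
normalization, the Clebsch–Gordan coefficient in the form of Racah's single sum. -/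
def racahCoeff (p q r i₁ i₂ : ℕ) : ℤ :=
  ∑ s ∈ antidiagonal p, if s.1 ≤ i₁ ∧ s.2 ≤ i₂ then
    (-1) ^ s.2 * p.choose s.2 * q.choose (i₂ - s.2) * r.choose (i₁ - s.1) else 0

lemma racahCoeff_eq_zero {p q r i₁ i₂ : ℕ} (h : i₁ + i₂ < p ∨ p + (q + r) < i₁ + i₂) :
    racahCoeff p q r i₁ i₂ = 0 := by
  refine Finset.sum_eq_zero fun s hs => ?_
  rw [mem_antidiagonal] at hs
  split_ifs with hle
  · have hlt : q < i₂ - s.2 ∨ r < i₁ - s.1 := by lia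
    rcases hlt with hlt | hlt <;> simp [Nat.choose_eq_zero_of_lt hlt]
  · rfl

lemma coeff_coeff_sub_pow_mul_linPowCoeff {R : Type*} [CommRing R] (p q r i i₁ i₂ : ℕ) :
    (((Y - C X) ^ p * linPowCoeff (R := R[X][Y]) (C X) 1 Y 1 q r i).coeff i₁).coeff i₂ =
      if i₁ + i₂ = p + i then (racahCoeff p q r i₁ i₂ : R) else 0 := by
  set x : R[X][Y] := Y
  set u : R[X][Y] := C X
  have hmonomial (k : ℤ) (a b : ℕ) :
      ((k * (x ^ a * u ^ b)).coeff i₁).coeff i₂ = if a = i₁ ∧ b = i₂ then (k : R) else 0 := by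
    rw [← C_eq_intCast, ← C_eq_intCast, show C (C (k : R)) * (x ^ a * u ^ b) =
      C (C (k : R) * X ^ b) * Y ^ a by simp only [map_intCast, map_mul, map_pow, x, u]; ring,
      coeff_C_mul_X_pow]
    split_ifs <;> simp_all [eq_comm]
  have hexpand : (x - u) ^ p * linPowCoeff u 1 x 1 q r i =
      ∑ s ∈ antidiagonal p, ∑ t ∈ antidiagonal i,
        (((-1) ^ s.2 * p.choose s.2 * q.choose t.1 * r.choose t.2 : ℤ) : R[X][Y]) *
          (x ^ (s.1 + t.2) * u ^ (s.2 + t.1)) := by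
    rw [linPowCoeff_eq_sum, sub_eq_add_neg, (Commute.all _ _).add_pow', Finset.sum_mul_sum]
    refine Finset.sum_congr rfl fun s hs => Finset.sum_congr rfl fun t _ => ?_
    rw [← Nat.choose_symm_of_eq_add (mem_antidiagonal.mp hs).symm]
    rw [neg_pow, nsmul_eq_mul]
    push_cast
    ring
  simp only [hexpand, finsetSum_coeff, hmonomial]
  split_ifs with hi
  · rw [racahCoeff, Int.cast_sum]
    refine Finset.sum_congr rfl fun s hs => ?_
    rw [mem_antidiagonal] at hs
    split_ifs with hle
    · rw [Finset.sum_eq_single (i₂ - s.2, i₁ - s.1)]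
      · simp [hle]
      · rintro t - ht
        exact if_neg fun h => ht (Prod.ext (by dsimp; lia) (by dsimp; lia))
      · exact fun h => absurd (mem_antidiagonal.mpr (by dsimp; lia)) h
    · rw [Int.cast_zero]
      exact Finset.sum_eq_zero fun t _ => if_neg (by lia)
  · refine Finset.sum_eq_zero fun s hs => Finset.sum_eq_zero fun t ht => if_neg ?_
    rw [mem_antidiagonal] at hs ht
    lia

lemma eq_of_evalEval_eq {P Q : K[X][Y]} (h : ∀ x y, P.evalEval x y = Q.evalEval x y) : P = Q :=
  eq_of_infinite_eval_eq P Q <| (Set.infinite_range_of_injective C_injective).mono <| by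
    rintro _ ⟨y, rfl⟩
    exact Polynomial.funext fun x => h x y

/-- Homogeneity: the coefficient of `x ^ i₁ * u ^ i₂` on the right only involves the terms with
`i₁ + i₂ = p + k`. -/
lemma coeff_mul_coeff_eq_sum_racahCoeff {P Q : K[X]} {m n : ℕ} {e : ℕ → ℕ → K}
    (h : ∀ x u, P.eval x * Q.eval u = ∑ p ∈ Finset.range (m + 1),
      ∑ k ∈ antidiagonal (n - p + (m - p)),
        e p k.1 * ((x - u) ^ p * linPowCoeff u 1 x 1 (n - p) (m - p) k.1)) (i₁ i₂ : ℕ) :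
    P.coeff i₁ * Q.coeff i₂ = ∑ p ∈ Finset.range (m + 1),
      e p (i₁ + i₂ - p) * racahCoeff p (n - p) (m - p) i₁ i₂ := by
  have hpoly : P.map C * C Q = ∑ p ∈ Finset.range (m + 1),
      ∑ k ∈ antidiagonal (n - p + (m - p)), C (C (e p k.1)) *
        ((Y - C X) ^ p * linPowCoeff (R := K[X][Y]) (C X) 1 Y 1 (n - p) (m - p) k.1) := by
    refine eq_of_evalEval_eq fun u x => ?_
    have hlin (q r k : ℕ) : (linPowCoeff (R := K[X][Y]) (C X) 1 Y 1 q r k).evalEval u x =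
        linPowCoeff u 1 x 1 q r k := by
      rw [← coe_evalEvalRingHom, map_linPowCoeff]
      simp
    simp only [evalEval_mul, evalEval_map_C, evalEval_C, h, evalEval_finsetSum, eval_C,
      evalEval_pow, evalEval_sub, evalEval_X, eval_X, hlin]
  have hcoeff := congrArg (fun F => (F.coeff i₁).coeff i₂) hpoly
  simp only [coeff_mul_C, coeff_map, coeff_C_mul, finsetSum_coeff,
    coeff_coeff_sub_pow_mul_linPowCoeff] at hcoeff
  refine hcoeff.trans (Finset.sum_congr rfl fun p _ => ?_)
  by_cases hi : i₁ + i₂ < p ∨ p + (n - p + (m - p)) < i₁ + i₂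
  · simp [racahCoeff_eq_zero hi]
  · rw [Finset.sum_eq_single (i₁ + i₂ - p, p + (n - p + (m - p)) - (i₁ + i₂))]
    · rw [if_pos (by dsimp; lia)]
    · rintro k hk hne
      rw [mem_antidiagonal] at hk
      rw [if_neg fun h => hne (Prod.ext (by dsimp; lia) (by dsimp; lia)), mul_zero]
    · exact fun h => absurd (mem_antidiagonal.mpr (by dsimp; lia)) h

lemma monomial_mul_monomial_eq_sum (y₀ y₁ v₀ v₁ : K) (m n i₁ i₂ : ℕ) :
    (m.choose i₁ * y₀ ^ i₁ * y₁ ^ (m - i₁)) * (n.choose i₂ * v₀ ^ i₂ * v₁ ^ (n - i₂)) =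
      ∑ p ∈ Finset.range (m + 1), cgWeight m n p * (y₀ * v₁ - y₁ * v₀) ^ p *
        (linPowCoeff v₀ v₁ y₀ y₁ (n - p) (m - p) (i₁ + i₂ - p) /
          (n - p + (m - p)).choose (i₁ + i₂ - p)) * racahCoeff p (n - p) (m - p) i₁ i₂ := by
  rw [← coeff_linear_pow, ← coeff_linear_pow]
  refine coeff_mul_coeff_eq_sum_racahCoeff (e := fun p k => cgWeight m n p *
    (y₀ * v₁ - y₁ * v₀) ^ p * (linPowCoeff v₀ v₁ y₀ y₁ (n - p) (m - p) k /
      (n - p + (m - p)).choose k)) (fun x u => ?_) i₁ i₂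
  simpa using linear_pow_mul_linear_pow_eq_sum x y₀ y₁ u v₀ v₁ m n

lemma linear_monomial_mul_linear_monomial_eq_sum (a b c d x u : K) (m n i₁ i₂ : ℕ) :
    (m.choose i₁ * (a * x + b) ^ i₁ * (c * x + d) ^ (m - i₁)) *
        (n.choose i₂ * (a * u + b) ^ i₂ * (c * u + d) ^ (n - i₂)) =
      ∑ p ∈ Finset.range (m + 1), ∑ k ∈ antidiagonal (n - p + (m - p)),
        cgWeight m n p * (a * d - b * c) ^ p * racahCoeff p (n - p) (m - p) i₁ i₂ *
          (linPowCoeff a b c d (i₁ + i₂ - p) (n - p + (m - p) - (i₁ + i₂ - p)) k.1 /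
            (n - p + (m - p)).choose k.1) *
          ((x - u) ^ p * linPowCoeff u 1 x 1 (n - p) (m - p) k.1) := by
  rw [monomial_mul_monomial_eq_sum]
  refine Finset.sum_congr rfl fun p _ => ?_
  by_cases hi : i₁ + i₂ < p ∨ p + (n - p + (m - p)) < i₁ + i₂
  · simp [racahCoeff_eq_zero hi]
  · have hcomp := sum_linPowCoeff_mul_linPowCoeff_div_choose u 1 x 1 a b c d
      (q := n - p) (r := m - p) (i := i₁ + i₂ - p) (by lia)
    have hdet : (a * x + b) * (c * u + d) - (c * x + d) * (a * u + b) =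
      (a * d - b * c) * (x - u) := by ring
    simp only [one_mul, mul_comm u, mul_comm x] at hcomp
    rw [← hcomp, hdet, mul_pow, Finset.mul_sum, Finset.sum_mul]
    exact Finset.sum_congr rfl fun k _ => by ring

lemma linPowCoeff_mul_linPowCoeff_eq_sum (a b c d : K) (m n i₁ i₂ j₁ j₂ : ℕ) :
    (m.choose i₁ * linPowCoeff a b c d i₁ (m - i₁) j₁) *
        (n.choose i₂ * linPowCoeff a b c d i₂ (n - i₂) j₂) =
      ∑ p ∈ Finset.range (m + 1), cgWeight m n p * (a * d - b * c) ^ p *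
        racahCoeff p (n - p) (m - p) i₁ i₂ *
          (linPowCoeff a b c d (i₁ + i₂ - p) (n - p + (m - p) - (i₁ + i₂ - p)) (j₁ + j₂ - p) /
            (n - p + (m - p)).choose (j₁ + j₂ - p)) *
          racahCoeff p (n - p) (m - p) j₁ j₂ := by
  rw [linPowCoeff, linPowCoeff, ← coeff_C_mul, ← coeff_C_mul]
  refine coeff_mul_coeff_eq_sum_racahCoeff (m := m) (n := n)
    (e := fun p k => cgWeight m n p * (a * d - b * c) ^ p *
      racahCoeff p (n - p) (m - p) i₁ i₂ *
        (linPowCoeff a b c d (i₁ + i₂ - p) (n - p + (m - p) - (i₁ + i₂ - p)) k /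
          (n - p + (m - p)).choose k)) (fun x u => ?_) j₁ j₂
  simpa [mul_assoc] using linear_monomial_mul_linear_monomial_eq_sum a b c d x u m n i₁ i₂

end Racah

section WignerThreeJ

open Finset.HasAntidiagonal (antidiagonal mem_antidiagonal)

lemma cgWeight_add_add (p q r : ℕ) :
    cgWeight (p + r) (p + q) p = (q + r + 1) *
      ((p + r).factorial * (p + q).factorial * (q + r).factorial /
        ((p + q + r + 1).factorial * p.factorial * q.factorial * r.factorial)) := by
  rw [cgWeight, show p + r + (p + q) + 1 - p = p + (q + r + 1) by lia, Nat.cast_add_choose,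
    Nat.cast_add_choose, Nat.cast_add_choose, Nat.factorial_succ, ← add_assoc, ← add_assoc]
  push_cast
  field_simp

lemma racah_sum_eq_racahCoeff {l₁ l₂ l₃ p q r i₁ i₂ : ℕ} {k₁ k₂ : ℤ} (hp : l₁ + l₂ = l₃ + p)
    (hq : l₂ + l₃ = l₁ + q) (hr : l₁ + l₃ = l₂ + r) (hi₁ : (i₁ : ℤ) = l₁ + k₁)
    (hi₂ : (i₂ : ℤ) = l₂ + k₂) :
    ∑ t ∈ (Finset.range (l₁ + l₂ - l₃ + 1)).filter (fun t : ℕ =>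
        0 ≤ (l₃ : ℤ) - l₂ + t + k₁ ∧ 0 ≤ (l₃ : ℤ) - l₁ + t - k₂ ∧
        0 ≤ (l₁ : ℤ) - t - k₁ ∧ 0 ≤ (l₂ : ℤ) - t + k₂),
      (-1 : ℝ) ^ t /
        ((t.factorial : ℝ) * (((l₃ : ℤ) - l₂ + t + k₁).toNat.factorial : ℝ) *
          (((l₃ : ℤ) - l₁ + t - k₂).toNat.factorial : ℝ) *
          ((l₁ + l₂ - l₃ - t).factorial : ℝ) *
          (((l₁ : ℤ) - t - k₁).toNat.factorial : ℝ) *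
          (((l₂ : ℤ) - t + k₂).toNat.factorial : ℝ)) =
      racahCoeff p q r i₁ i₂ / (p.factorial * q.factorial * r.factorial) := by
  obtain rfl : p = l₁ + l₂ - l₃ := by lia
  rw [Finset.sum_filter, racahCoeff, ← Finset.Nat.sum_antidiagonal_swap,
    Finset.Nat.sum_antidiagonal_eq_sum_range_succ_mk, Int.cast_sum, Finset.sum_div]
  refine Finset.sum_congr rfl fun t ht => ?_
  rw [Finset.mem_range_succ_iff] at ht
  dsimp only [Prod.swap_prod_mk]
  by_cases hle : l₁ + l₂ - l₃ - t ≤ i₁ ∧ t ≤ i₂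
  · rw [if_pos hle]
    by_cases hle' : i₂ - t ≤ q ∧ i₁ - (l₁ + l₂ - l₃ - t) ≤ r
    · rw [if_pos (by lia),
        show ((l₃ : ℤ) - l₂ + t + k₁).toNat = i₁ - (l₁ + l₂ - l₃ - t) by lia,
        show ((l₃ : ℤ) - l₁ + t - k₂).toNat = q - (i₂ - t) by lia,
        show ((l₁ : ℤ) - t - k₁).toNat = r - (i₁ - (l₁ + l₂ - l₃ - t)) by lia,
        show ((l₂ : ℤ) - t + k₂).toNat = i₂ - t by lia]
      push_cast [Nat.cast_choose ℝ ht, Nat.cast_choose ℝ hle'.1, Nat.cast_choose ℝ hle'.2]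
      field_simp
    · rw [if_neg (by lia)]
      rcases not_and_or.mp hle' with h | h <;> simp [Nat.choose_eq_zero_of_lt (not_le.mp h)]
  · rw [if_neg hle, if_neg (by lia), Int.cast_zero, zero_div]

lemma factorial_mul_factorial_eq_div_choose {n i : ℕ} (hi : i ≤ n) :
    (i.factorial * (n - i).factorial : ℝ) = n.factorial / n.choose i := by
  rw [Nat.cast_choose ℝ hi]
  field_simp

lemma sqrt_mul_sqrt_div_factorial_eq {p q r i j k : ℕ} (hi : i ≤ p + r) (hj : j ≤ p + q)
    (hk : k ≤ q + r) :
    √(p.factorial * r.factorial * q.factorial / (p + q + r + 1).factorial) *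
        √(i.factorial * (p + r - i).factorial * j.factorial * (p + q - j).factorial *
          (q + r - k).factorial * k.factorial) / (p.factorial * q.factorial * r.factorial) =
      √(cgWeight (p + r) (p + q) p / (q + r + 1)) /
        (√((p + r).choose i) * √((p + q).choose j) * √((q + r).choose k)) := by
  have hfac : (i.factorial * (p + r - i).factorial * j.factorial * (p + q - j).factorial *
      (q + r - k).factorial * k.factorial : ℝ) =
        (p + r).factorial * (p + q).factorial * (q + r).factorial /
          ((p + r).choose i * (p + q).choose j * (q + r).choose k) := by
    calc _ = (i.factorial * (p + r - i).factorial) * (j.factorial * (p + q - j).factorial) *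
        (k.factorial * (q + r - k).factorial : ℝ) := by ring
      _ = _ := by
        rw [factorial_mul_factorial_eq_div_choose hi, factorial_mul_factorial_eq_div_choose hj,
          factorial_mul_factorial_eq_div_choose hk]
        ring
  have hpos : (0 : ℝ) ≤ p.factorial * q.factorial * r.factorial := by positivity
  rw [hfac, cgWeight_add_add]
  push_cast
  rw [← Real.sqrt_mul (by positivity), ← Real.sqrt_mul (by positivity),
    ← Real.sqrt_mul (by positivity), ← Real.sqrt_div (by positivity)]
  conv_lhs => rw [← Real.sqrt_sq hpos, ← Real.sqrt_div (by positivity)]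
  congr 1
  field_simp

lemma wigner3j_eq_zero_of_abs_lt {l₁ l₂ l₃ : ℕ} {k₁ k₂ k₃ : ℤ} (h : (l₃ : ℤ) < |k₃|) :
    wigner3j l₁ l₂ l₃ k₁ k₂ k₃ = 0 :=
  if_neg fun h' => h.not_ge h'.2.2.1

lemma wigner3j_eq_racahCoeff {l₁ l₂ l₃ p q r i₁ i₂ : ℕ} {k₁ k₂ : ℤ} (hp : l₁ + l₂ = l₃ + p)
    (hq : l₂ + l₃ = l₁ + q) (hr : l₁ + l₃ = l₂ + r) (hi₁ : (i₁ : ℤ) = l₁ + k₁)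
    (hi₂ : (i₂ : ℤ) = l₂ + k₂) (hk₁ : |k₁| ≤ l₁) (hk₂ : |k₂| ≤ l₂) :
    wigner3j l₁ l₂ l₃ k₁ k₂ (-(k₁ + k₂)) =
      (-1) ^ (l₁ - l₂ + (k₁ + k₂)) * √(cgWeight (p + r) (p + q) p / (q + r + 1)) *
        (racahCoeff p q r i₁ i₂ /
          (√((p + r).choose i₁) * √((p + q).choose i₂) * √((q + r).choose (i₁ + i₂ - p)))) := by
  rcases lt_or_ge (l₃ : ℤ) |-(k₁ + k₂)| with hk | hk
  · rw [wigner3j_eq_zero_of_abs_lt hk, racahCoeff_eq_zero]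
    · simp
    · rw [abs_neg, lt_abs] at hk
      lia
  rw [wigner3j, if_pos ⟨hk₁, hk₂, hk, by ring, by rw [abs_le]; lia, by lia⟩,
    racah_sum_eq_racahCoeff hp hq hr hi₁ hi₂, sub_neg_eq_add]
  rw [abs_le] at hk hk₁ hk₂
  rw [show ((l₁ : ℤ) + k₁).toNat = i₁ by lia, show ((l₁ : ℤ) - k₁).toNat = p + r - i₁ by lia,
    show ((l₂ : ℤ) + k₂).toNat = i₂ by lia, show ((l₂ : ℤ) - k₂).toNat = p + q - i₂ by lia,
    show ((l₃ : ℤ) + -(k₁ + k₂)).toNat = q + r - (i₁ + i₂ - p) by lia,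
    show ((l₃ : ℤ) - -(k₁ + k₂)).toNat = i₁ + i₂ - p by lia,
    show l₁ + l₂ - l₃ = p by lia, show l₁ + l₃ - l₂ = r by lia, show l₂ + l₃ - l₁ = q by lia,
    show l₁ + l₂ + l₃ = p + q + r by lia]
  have hsqrt := sqrt_mul_sqrt_div_factorial_eq (p := p) (q := q) (r := r) (i := i₁) (j := i₂)
    (k := i₁ + i₂ - p) (by lia) (by lia) (by lia)
  linear_combination ((-1) ^ (l₁ - l₂ + (k₁ + k₂)) * racahCoeff p q r i₁ i₂ : ℝ) * hsqrt

end WignerThreeJ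

section Rotations

/-- Matrix coefficient, for orders `-l ≤ k, n ≤ l`, of the substitution by `!![c, -s; s, c]` on
binary forms of degree `2 * l` in the basis of normalized monomials
`√((2 * l).choose (l + n)) * X ^ (l + n)`. For `c = cos (θ / 2)` and `s = sin (θ / 2)` this is
the Wigner d-function. -/
noncomputable def rotMatrix (c s : ℝ) (l : ℕ) (k n : ℤ) : ℝ :=
  √((2 * l).choose (l + k).toNat) / √((2 * l).choose (l + n).toNat) *
    linPowCoeff c (-s) s c (l + k).toNat (l - k).toNat (l + n).toNat

lemma rotMatrix_eq (c s : ℝ) {l N i j : ℕ} {k n : ℤ} (hN : N = 2 * l) (hi : (i : ℤ) = l + k)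
    (hj : (j : ℤ) = l + n) :
    rotMatrix c s l k n = √(N.choose i) / √(N.choose j) * linPowCoeff c (-s) s c i (N - i) j := by
  rw [rotMatrix, ← hi, ← hj, ← hN, show (l - k).toNat = N - i by lia]
  rfl

lemma sqrt_choose_ne_zero {n i : ℕ} (hi : i ≤ n) : √(n.choose i : ℝ) ≠ 0 :=
  (Real.sqrt_pos.mpr (by exact_mod_cast Nat.choose_pos hi)).ne'

lemma linPowCoeff_rotation_neg (c s : ℝ) (q r i : ℕ) :
    linPowCoeff c s (-s) c q r i = (-1) ^ (q + i) * linPowCoeff c (-s) s c q r i := by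
  have hrow := linPowCoeff_row_mul (-1) 1 (-c) (-s) (-s) c q r i
  have hcol := linPowCoeff_mul_column (-1) c (-s) s c q r i
  simp only [neg_mul_neg, one_mul, one_pow, mul_one, mul_neg_one] at hrow hcol
  rw [hrow, hcol]
  ring

lemma rotMatrix_swap (c s : ℝ) {l : ℕ} {k n : ℤ} (hk : |k| ≤ l) (hn : |n| ≤ l) :
    rotMatrix c s l n k = (-1) ^ (k - n) * rotMatrix c s l k n := by
  rw [abs_le] at hk hn
  obtain ⟨i, hi⟩ := Int.eq_ofNat_of_zero_le (show 0 ≤ l + k by lia)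
  obtain ⟨j, hj⟩ := Int.eq_ofNat_of_zero_le (show 0 ≤ l + n by lia)
  have hi₀ := sqrt_choose_ne_zero (show i ≤ 2 * l by lia)
  have hj₀ := sqrt_choose_ne_zero (show j ≤ 2 * l by lia)
  have hsq (i : ℕ) := Real.mul_self_sqrt (Nat.cast_nonneg (α := ℝ) ((2 * l).choose i))
  have h := choose_mul_linPowCoeff c (-s) s c (n := 2 * l) (i := i) (j := j)
  rw [linPowCoeff_rotation_neg, ← hsq i, ← hsq j] at h
  have hsign : (-1 : ℝ) ^ (k - n) * (-1) ^ (j + i) = 1 := by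
    rw [← zpow_natCast, ← zpow_add₀ (by norm_num)]
    exact Even.neg_one_zpow ⟨l + k, by lia⟩
  rw [rotMatrix_eq c s rfl hi.symm hj.symm, rotMatrix_eq c s rfl hj.symm hi.symm]
  field_simp
  linear_combination (-(-1) ^ (k - n)) * h -
    √((2 * l).choose j) * √((2 * l).choose j) * linPowCoeff c (-s) s c j (2 * l - j) i * hsign

lemma rotMatrix_neg_neg (c s : ℝ) {l : ℕ} {k n : ℤ} (hk : |k| ≤ l) (hn : |n| ≤ l) :
    rotMatrix c s l (-k) (-n) = (-1) ^ (k - n) * rotMatrix c s l k n := by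
  rw [abs_le] at hk hn
  obtain ⟨i, hi⟩ := Int.eq_ofNat_of_zero_le (show 0 ≤ l + k by lia)
  obtain ⟨j, hj⟩ := Int.eq_ofNat_of_zero_le (show 0 ≤ l + n by lia)
  have hrev : linPowCoeff c (-s) s c (2 * l - i) i (2 * l - j) =
      linPowCoeff c s (-s) c i (2 * l - i) j := by
    rw [← linPowCoeff_swap_rows, ← linPowCoeff_swap_columns _ _ _ _ (by lia),
      show i + (2 * l - i) - (2 * l - j) = j by lia]
  have hsign : (-1 : ℝ) ^ (i + j) = (-1) ^ (k - n) := by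
    rw [← zpow_natCast, show ((i + j : ℕ) : ℤ) = k - n + 2 * (l + n) by lia,
      zpow_add₀ (by norm_num), zpow_mul]
    simp
  rw [rotMatrix_eq c s rfl hi.symm hj.symm,
    rotMatrix_eq c s rfl (i := 2 * l - i) (j := 2 * l - j) (by lia) (by lia),
    Nat.choose_symm (by lia), Nat.choose_symm (by lia), show 2 * l - (2 * l - i) = i by lia, hrev,
    linPowCoeff_rotation_neg, hsign]
  ring

lemma sign_mul_wigner3j_mul_wigner3j {l₁ l₂ l p q r i₁ i₂ j₁ j₂ : ℕ} {k₁ k₂ n₁ n₂ : ℤ}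
    (hp : l₁ + l₂ = l + p) (hq : l₂ + l = l₁ + q) (hr : l₁ + l = l₂ + r)
    (hi₁ : (i₁ : ℤ) = l₁ + k₁) (hi₂ : (i₂ : ℤ) = l₂ + k₂) (hj₁ : (j₁ : ℤ) = l₁ + n₁)
    (hj₂ : (j₂ : ℤ) = l₂ + n₂) (hk₁ : |k₁| ≤ l₁) (hk₂ : |k₂| ≤ l₂) (hn₁ : |n₁| ≤ l₁)
    (hn₂ : |n₂| ≤ l₂) :
    (-1) ^ (k₁ + k₂ + n₁ + n₂) * (2 * l + 1) * wigner3j l₁ l₂ l k₁ k₂ (-(k₁ + k₂)) *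
        wigner3j l₁ l₂ l n₁ n₂ (-(n₁ + n₂)) =
      cgWeight (p + r) (p + q) p *
        (racahCoeff p q r i₁ i₂ /
          (√((p + r).choose i₁) * √((p + q).choose i₂) * √((q + r).choose (i₁ + i₂ - p)))) *
        (racahCoeff p q r j₁ j₂ /
          (√((p + r).choose j₁) * √((p + q).choose j₂) * √((q + r).choose (j₁ + j₂ - p)))) := by
  rw [wigner3j_eq_racahCoeff hp hq hr hi₁ hi₂ hk₁ hk₂,
    wigner3j_eq_racahCoeff hp hq hr hj₁ hj₂ hn₁ hn₂]
  have hsign : (-1 : ℝ) ^ (k₁ + k₂ + n₁ + n₂) * (-1) ^ (l₁ - l₂ + (k₁ + k₂)) *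
      (-1) ^ (l₁ - l₂ + (n₁ + n₂)) = 1 := by
    rw [← zpow_add₀ (by norm_num), ← zpow_add₀ (by norm_num)]
    exact Even.neg_one_zpow ⟨l₁ - l₂ + k₁ + k₂ + n₁ + n₂, by ring⟩
  set σ : ℝ := √(cgWeight (p + r) (p + q) p / (q + r + 1)) with hσ
  have hweight : (cgWeight (p + r) (p + q) p : ℝ) = (2 * l + 1) * (σ * σ) := by
    have hl : (2 * l : ℝ) = q + r := by exact_mod_cast (by lia : 2 * l = q + r)
    rw [hσ, Real.mul_self_sqrt, hl]
    · field_simp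
    · rw [cgWeight_add_add]
      push_cast
      positivity
  rw [hweight]
  linear_combination (2 * l + 1) * (σ * σ) *
    (racahCoeff p q r i₁ i₂ /
      (√((p + r).choose i₁) * √((p + q).choose i₂) * √((q + r).choose (i₁ + i₂ - p)))) *
    (racahCoeff p q r j₁ j₂ /
      (√((p + r).choose j₁) * √((p + q).choose j₂) * √((q + r).choose (j₁ + j₂ - p)))) * hsign

lemma cgWeight_mul_linPowCoeff_eq (c s : ℝ) {l₁ l₂ l p q r i₁ i₂ j₁ j₂ : ℕ} {k₁ k₂ n₁ n₂ : ℤ}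
    (hp : l₁ + l₂ = l + p) (hq : l₂ + l = l₁ + q) (hr : l₁ + l = l₂ + r)
    (hi₁ : (i₁ : ℤ) = l₁ + k₁) (hi₂ : (i₂ : ℤ) = l₂ + k₂) (hj₁ : (j₁ : ℤ) = l₁ + n₁)
    (hj₂ : (j₂ : ℤ) = l₂ + n₂) (hk₁ : |k₁| ≤ l₁) (hk₂ : |k₂| ≤ l₂) (hn₁ : |n₁| ≤ l₁)
    (hn₂ : |n₂| ≤ l₂) :
    cgWeight (p + r) (p + q) p * racahCoeff p q r i₁ i₂ *
        (linPowCoeff c (-s) s c (i₁ + i₂ - p) (q + r - (i₁ + i₂ - p)) (j₁ + j₂ - p) /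
          (q + r).choose (j₁ + j₂ - p)) * racahCoeff p q r j₁ j₂ =
      √((p + r).choose i₁) * √((p + q).choose i₂) * √((p + r).choose j₁) *
        √((p + q).choose j₂) * ((-1) ^ (k₁ + k₂ + n₁ + n₂) * (2 * l + 1) *
          wigner3j l₁ l₂ l k₁ k₂ (-(k₁ + k₂)) * wigner3j l₁ l₂ l n₁ n₂ (-(n₁ + n₂)) *
          rotMatrix c s l (k₁ + k₂) (n₁ + n₂)) := by
  rw [sign_mul_wigner3j_mul_wigner3j hp hq hr hi₁ hi₂ hj₁ hj₂ hk₁ hk₂ hn₁ hn₂]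
  by_cases hi : i₁ + i₂ < p ∨ p + (q + r) < i₁ + i₂
  · simp [racahCoeff_eq_zero hi]
  by_cases hj : j₁ + j₂ < p ∨ p + (q + r) < j₁ + j₂
  · simp [racahCoeff_eq_zero hj]
  rw [abs_le] at hk₁ hk₂ hn₁ hn₂
  have hi₁' := sqrt_choose_ne_zero (show i₁ ≤ p + r by lia)
  have hi₂' := sqrt_choose_ne_zero (show i₂ ≤ p + q by lia)
  have hi' := sqrt_choose_ne_zero (show i₁ + i₂ - p ≤ q + r by lia)
  have hj₁' := sqrt_choose_ne_zero (show j₁ ≤ p + r by lia)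
  have hj₂' := sqrt_choose_ne_zero (show j₂ ≤ p + q by lia)
  rw [rotMatrix_eq c s (i := i₁ + i₂ - p) (j := j₁ + j₂ - p) (show q + r = 2 * l by lia)
    (by lia) (by lia)]
  field_simp
  rw [Real.sq_sqrt (Nat.cast_nonneg _)]

lemma sum_range_cgWeight_mul (l₁ l₂ : ℕ) (f : ℕ → ℝ) :
    ∑ p ∈ Finset.range (2 * l₁ + 1), cgWeight (2 * l₁) (2 * l₂) p * f p =
      ∑ l ∈ Finset.Icc ((l₂ : ℤ) - l₁).natAbs (l₁ + l₂),
        cgWeight (2 * l₁) (2 * l₂) (l₁ + l₂ - l) * f (l₁ + l₂ - l) := by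
  refine (Finset.sum_of_injOn (fun l => l₁ + l₂ - l) ?_ ?_ ?_ fun _ _ => rfl).symm
  · intro l hl l' hl' hll'
    simp only [Finset.coe_Icc, Set.mem_Icc] at hl hl' hll'
    lia
  · intro l hl
    simp only [Finset.coe_Icc, Set.mem_Icc, Finset.coe_range, Set.mem_Iio] at hl ⊢
    lia
  · intro p hp hp'
    rw [Finset.mem_range] at hp
    rw [cgWeight_eq_zero_of_lt, Rat.cast_zero, zero_mul]
    by_contra!
    exact hp' ⟨l₁ + l₂ - p, by simp only [Finset.coe_Icc, Set.mem_Icc]; lia, by dsimp; lia⟩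

lemma rotMatrix_mul_rotMatrix {c s : ℝ} (h : c ^ 2 + s ^ 2 = 1) {l₁ l₂ : ℕ} {k₁ k₂ n₁ n₂ : ℤ}
    (hk₁ : |k₁| ≤ l₁) (hk₂ : |k₂| ≤ l₂) (hn₁ : |n₁| ≤ l₁) (hn₂ : |n₂| ≤ l₂) :
    rotMatrix c s l₁ k₁ n₁ * rotMatrix c s l₂ k₂ n₂ =
      ∑ l ∈ Finset.Icc ((l₂ : ℤ) - l₁).natAbs (l₁ + l₂),
        (-1) ^ (k₁ + k₂ + n₁ + n₂) * (2 * l + 1) *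
          wigner3j l₁ l₂ l k₁ k₂ (-(k₁ + k₂)) * wigner3j l₁ l₂ l n₁ n₂ (-(n₁ + n₂)) *
          rotMatrix c s l (k₁ + k₂) (n₁ + n₂) := by
  obtain ⟨i₁, hi₁⟩ := Int.eq_ofNat_of_zero_le (show 0 ≤ l₁ + k₁ by rw [abs_le] at hk₁; lia)
  obtain ⟨i₂, hi₂⟩ := Int.eq_ofNat_of_zero_le (show 0 ≤ l₂ + k₂ by rw [abs_le] at hk₂; lia)
  obtain ⟨j₁, hj₁⟩ := Int.eq_ofNat_of_zero_le (show 0 ≤ l₁ + n₁ by rw [abs_le] at hn₁; lia)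
  obtain ⟨j₂, hj₂⟩ := Int.eq_ofNat_of_zero_le (show 0 ≤ l₂ + n₂ by rw [abs_le] at hn₂; lia)
  have hi₁' := sqrt_choose_ne_zero (show i₁ ≤ 2 * l₁ by rw [abs_le] at hk₁; lia)
  have hi₂' := sqrt_choose_ne_zero (show i₂ ≤ 2 * l₂ by rw [abs_le] at hk₂; lia)
  have hj₁' := sqrt_choose_ne_zero (show j₁ ≤ 2 * l₁ by rw [abs_le] at hn₁; lia)
  have hj₂' := sqrt_choose_ne_zero (show j₂ ≤ 2 * l₂ by rw [abs_le] at hn₂; lia)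
  have hsq (n i : ℕ) : (n.choose i : ℝ) = √(n.choose i) * √(n.choose i) :=
    (Real.mul_self_sqrt (Nat.cast_nonneg _)).symm
  have hcg := linPowCoeff_mul_linPowCoeff_eq_sum c (-s) s c (2 * l₁) (2 * l₂) i₁ i₂ j₁ j₂
  rw [show c * c - -s * s = 1 by linear_combination h, hsq _ i₁, hsq _ i₂] at hcg
  simp only [one_pow, mul_one, mul_assoc (cgWeight _ _ _ : ℝ)] at hcg
  rw [sum_range_cgWeight_mul] at hcg
  refine mul_left_cancel₀ (mul_ne_zero (mul_ne_zero (mul_ne_zero hi₁' hi₂') hj₁') hj₂') ?_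
  rw [Finset.mul_sum, rotMatrix_eq c s rfl hi₁.symm hj₁.symm,
    rotMatrix_eq c s rfl hi₂.symm hj₂.symm]
  refine Eq.trans (by field_simp) (hcg.trans (Finset.sum_congr rfl fun l hl => ?_))
  rw [Finset.mem_Icc] at hl
  rw [show 2 * l₁ = (l₁ + l₂ - l) + (l₁ + l - l₂) by lia,
    show 2 * l₂ = (l₁ + l₂ - l) + (l₂ + l - l₁) by lia, Nat.add_sub_cancel_left,
    Nat.add_sub_cancel_left,
    ← cgWeight_mul_linPowCoeff_eq c s (by lia) (by lia) (by lia) hi₁.symm hi₂.symm hj₁.symm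
      hj₂.symm hk₁ hk₂ hn₁ hn₂]
  ring

end Rotations

section Rodrigues

open Real (sin cos)

lemma eval_iterate_derivative_X_sub_C_pow_mul {R : Type*} [CommRing R] (a b x : R) (q r m : ℕ) :
    (derivative^[m] ((X - C a) ^ q * (X - C b) ^ r)).eval x =
      m.factorial * linPowCoeff 1 (x - a) 1 (x - b) q r m := by
  rw [← factorial_smul_hasseDeriv, LinearMap.smul_apply, eval_smul, ← taylor_coeff, taylor_mul,
    taylor_pow, taylor_pow, linPowCoeff, nsmul_eq_mul]
  simp [add_sub_assoc]

lemma eval_jacobiPoly (α ξ lam : ℕ) (x : ℝ) :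
    (1 - x) ^ ξ * (1 + x) ^ lam * (jacobiPoly α ξ lam).eval x =
      (-1) ^ ξ / 2 ^ α * linPowCoeff 1 (x - 1) 1 (x + 1) (α + ξ) (α + lam) α := by
  have hfactor : ((1 - X) ^ ξ * (1 + X) ^ lam * (1 - X ^ 2) ^ α : ℝ[X]) =
      C ((-1) ^ (ξ + α)) * ((X - C 1) ^ (α + ξ) * (X - C (-1)) ^ (α + lam)) := by
    have h₁ : (1 - X : ℝ[X]) = C (-1) * (X - C 1) := by simp
    have h₂ : (1 + X : ℝ[X]) = X - C (-1) := by simp [add_comm]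
    rw [show (1 - X ^ 2 : ℝ[X]) = (1 - X) * (1 + X) by ring, h₁, h₂, C_pow, mul_pow, mul_pow,
      mul_pow]
    ring
  have h := congrArg (eval x) (jacobiPoly_rodrigues α ξ lam)
  rw [hfactor, iterate_derivative_C_mul] at h
  simp only [eval_mul, eval_pow, eval_sub, eval_add, eval_one, eval_X, eval_C,
    eval_iterate_derivative_X_sub_C_pow_mul, sub_neg_eq_add] at h
  have hsign : (-1 : ℝ) ^ α * (-1) ^ α = 1 := by rw [← mul_pow]; simp
  rw [h, pow_add]
  field_simp
  linear_combination linPowCoeff 1 (x - 1) 1 (x + 1) (α + ξ) (α + lam) α * hsign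

lemma eval_iterate_derivative_sq_sub_one_pow (l m : ℕ) (x : ℝ) :
    (derivative^[m] ((X ^ 2 - 1 : ℝ[X]) ^ l)).eval x =
      m.factorial * linPowCoeff 1 (x - 1) 1 (x + 1) l l m := by
  have hfactor : (X ^ 2 - 1 : ℝ[X]) ^ l = (X - C 1) ^ l * (X - C (-1)) ^ l := by
    rw [← mul_pow]
    congr 1
    simp only [C_neg, C_1]
    ring
  rw [hfactor, eval_iterate_derivative_X_sub_C_pow_mul, sub_neg_eq_add]

lemma sin_eq_two_mul_sin_half_mul_cos_half (θ : ℝ) : sin θ = 2 * sin (θ / 2) * cos (θ / 2) := by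
  rw [← Real.sin_two_mul, mul_div_cancel₀ θ two_ne_zero]

lemma one_add_cos_eq_two_mul_cos_half_sq (θ : ℝ) : 1 + cos θ = 2 * cos (θ / 2) ^ 2 := by
  rw [Real.cos_sq, mul_div_cancel₀ θ two_ne_zero]
  ring

lemma one_sub_cos_eq_two_mul_sin_half_sq (θ : ℝ) : 1 - cos θ = 2 * sin (θ / 2) ^ 2 := by
  rw [Real.sin_sq, mul_sub, ← one_add_cos_eq_two_mul_cos_half_sq]
  ring

lemma two_sin_pow_mul_two_cos_pow_mul_linPowCoeff (θ : ℝ) (q r i : ℕ) :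
    (2 * sin (θ / 2)) ^ q * (2 * cos (θ / 2)) ^ r *
        linPowCoeff (cos (θ / 2)) (-sin (θ / 2)) (sin (θ / 2)) (cos (θ / 2)) q r i =
      sin θ ^ i * linPowCoeff 1 (cos θ - 1) 1 (cos θ + 1) q r i := by
  rw [← linPowCoeff_row_mul, ← linPowCoeff_mul_column, sin_eq_two_mul_sin_half_mul_cos_half θ,
    ← neg_sub 1, add_comm (cos θ), one_sub_cos_eq_two_mul_sin_half_sq,
    one_add_cos_eq_two_mul_cos_half_sq]
  congr 1 <;> ring

lemma eq_of_eq_of_sin_ne_zero {Y : Type*} [TopologicalSpace Y] [T2Space Y] {f g : ℝ → Y}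
    (hf : Continuous f) (hg : Continuous g) (h : ∀ θ, sin θ ≠ 0 → f θ = g θ) : f = g := by
  have hcount : {θ : ℝ | sin θ = 0}.Countable :=
    (Set.countable_range fun n : ℤ => (n : ℝ) * Real.pi).mono fun _ => Real.sin_eq_zero_iff.mp
  exact hf.ext_on (hcount.dense_compl ℝ) hg h

lemma continuous_linPowCoeff {Y R : Type*} [TopologicalSpace Y] [CommRing R] [TopologicalSpace R]
    [IsTopologicalRing R] {a b c d : Y → R} (ha : Continuous a) (hb : Continuous b)
    (hc : Continuous c) (hd : Continuous d) (q r i : ℕ) :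
    Continuous fun y => linPowCoeff (a y) (b y) (c y) (d y) q r i := by
  simp only [linPowCoeff_eq_sum]
  fun_prop

lemma linPowCoeff_half_angle_eq_jacobiPoly_of_sin_ne_zero (α ξ lam : ℕ) {θ : ℝ}
    (hθ : sin θ ≠ 0) :
    linPowCoeff (cos (θ / 2)) (-sin (θ / 2)) (sin (θ / 2)) (cos (θ / 2)) (α + ξ) (α + lam) α =
      (-sin (θ / 2)) ^ ξ * cos (θ / 2) ^ lam * (jacobiPoly α ξ lam).eval (cos θ) := by
  have hscale := two_sin_pow_mul_two_cos_pow_mul_linPowCoeff θ (α + ξ) (α + lam) α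
  have hjacobi := eval_jacobiPoly α ξ lam (cos θ)
  rw [one_sub_cos_eq_two_mul_sin_half_sq, one_add_cos_eq_two_mul_cos_half_sq] at hjacobi
  rw [sin_eq_two_mul_sin_half_mul_cos_half θ] at hθ hscale
  set L := linPowCoeff 1 (cos θ - 1) 1 (cos θ + 1) (α + ξ) (α + lam) α
  set c := cos (θ / 2)
  set s := sin (θ / 2)
  have hs : s ≠ 0 := right_ne_zero_of_mul (left_ne_zero_of_mul hθ)
  have hc : c ≠ 0 := right_ne_zero_of_mul hθ
  have hsign : (-1 : ℝ) ^ ξ * (-1) ^ ξ = 1 := by rw [← mul_pow]; simp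
  have hL : L = 2 ^ α * (-1) ^ ξ * ((2 * s ^ 2) ^ ξ * (2 * c ^ 2) ^ lam *
      (jacobiPoly α ξ lam).eval (cos θ)) := by
    rw [hjacobi]
    field_simp
    linear_combination -L * hsign
  refine mul_left_cancel₀ (by positivity : (2 * s) ^ (α + ξ) * (2 * c) ^ (α + lam) ≠ 0) ?_
  rw [hscale, hL, neg_pow s]
  ring

lemma linPowCoeff_half_angle_eq_jacobiPoly (α ξ lam : ℕ) (θ : ℝ) :
    linPowCoeff (cos (θ / 2)) (-sin (θ / 2)) (sin (θ / 2)) (cos (θ / 2)) (α + ξ) (α + lam) α =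
      (-sin (θ / 2)) ^ ξ * cos (θ / 2) ^ lam * (jacobiPoly α ξ lam).eval (cos θ) := by
  have hcont : Continuous fun θ : ℝ => linPowCoeff (cos (θ / 2)) (-sin (θ / 2)) (sin (θ / 2))
      (cos (θ / 2)) (α + ξ) (α + lam) α :=
    continuous_linPowCoeff (by fun_prop) (by fun_prop) (by fun_prop) (by fun_prop) _ _ _
  have hext := eq_of_eq_of_sin_ne_zero hcont (by fun_prop) fun θ hθ =>
    linPowCoeff_half_angle_eq_jacobiPoly_of_sin_ne_zero α ξ lam hθ
  exact congrFun hext θ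

lemma linPowCoeff_half_angle_self (l : ℕ) (θ : ℝ) :
    linPowCoeff 1 (cos θ - 1) 1 (cos θ + 1) l l l =
      2 ^ l * linPowCoeff (cos (θ / 2)) (-sin (θ / 2)) (sin (θ / 2)) (cos (θ / 2)) l l l := by
  have h := eval_jacobiPoly l 0 0 (cos θ)
  have h' := linPowCoeff_half_angle_eq_jacobiPoly l 0 0 θ
  simp only [pow_zero, one_mul, add_zero] at h h'
  rw [h', h]
  field_simp

lemma linPowCoeff_half_angle_eq_zero {l i : ℕ} (hi : i ≠ l) {θ : ℝ} (hθ : sin θ = 0) :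
    linPowCoeff (cos (θ / 2)) (-sin (θ / 2)) (sin (θ / 2)) (cos (θ / 2)) l l i = 0 := by
  rw [sin_eq_two_mul_sin_half_mul_cos_half, mul_assoc, mul_eq_zero_iff_left two_ne_zero,
    mul_eq_zero] at hθ
  rcases hθ with h | h <;>
    simp [linPowCoeff, h, mul_pow, ← C_pow, coeff_X_pow, hi, mul_assoc, -map_pow, -map_neg]

lemma assocLegendre_cos {l i : ℕ} {k : ℤ} (hi : (i : ℤ) = l + k) {θ : ℝ}
    (hθ : θ ∈ Set.Icc 0 Real.pi) :
    assocLegendre l k (cos θ) = (-1) ^ k * (i.factorial / l.factorial) *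
      linPowCoeff (cos (θ / 2)) (-sin (θ / 2)) (sin (θ / 2)) (cos (θ / 2)) l l i := by
  have hsin := Real.sin_nonneg_of_mem_Icc hθ
  have hpow : (1 - cos θ ^ 2) ^ ((k : ℝ) / 2) = sin θ ^ k := by
    rw [← Real.sin_sq, ← Real.rpow_natCast, ← Real.rpow_mul hsin, ← Real.rpow_intCast]
    congr 1
    push_cast
    ring
  suffices h : sin θ ^ k * linPowCoeff 1 (cos θ - 1) 1 (cos θ + 1) l l i =
      2 ^ l * linPowCoeff (cos (θ / 2)) (-sin (θ / 2)) (sin (θ / 2)) (cos (θ / 2)) l l i by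
    rw [assocLegendre, hpow, show (k + l).toNat = i by lia, eval_iterate_derivative_sq_sub_one_pow]
    field_simp
    linear_combination h
  rcases eq_or_ne k 0 with rfl | hk
  · obtain rfl : i = l := by lia
    rw [zpow_zero, one_mul, linPowCoeff_half_angle_self]
  · by_cases hθ₀ : sin θ = 0
    · rw [hθ₀, zero_zpow k hk, linPowCoeff_half_angle_eq_zero (by lia) hθ₀]
      simp
    · have hscale := two_sin_pow_mul_two_cos_pow_mul_linPowCoeff θ l l i
      rw [← mul_pow, show 2 * sin (θ / 2) * (2 * cos (θ / 2)) = 2 * sin θ by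
        rw [sin_eq_two_mul_sin_half_mul_cos_half θ]; ring] at hscale
      rw [show k = i - l by lia, zpow_sub₀ hθ₀, zpow_natCast, zpow_natCast]
      field_simp
      rw [← hscale]
      ring

lemma sqrt_choose_div_sqrt_choose {n i j : ℕ} (hi : i ≤ n) (hj : j ≤ n) :
    √(n.choose i) / √(n.choose j) =
      √((j.factorial * (n - j).factorial) / (i.factorial * (n - i).factorial)) := by
  rw [← Real.sqrt_div (Nat.cast_nonneg _), Nat.cast_choose ℝ hi, Nat.cast_choose ℝ hj]
  have := Nat.factorial_ne_zero n
  field_simp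

lemma wignerSmallD_swap (l : ℕ) (k n : ℤ) (θ : ℝ) :
    wignerSmallD l n k θ = (-1) ^ (k - n) * wignerSmallD l k n θ := by
  have hsign : (if n ≤ k then (1 : ℝ) else (-1) ^ (k - n)) =
      (-1) ^ (k - n) * if k ≤ n then (1 : ℝ) else (-1) ^ (n - k) := by
    rcases lt_trichotomy k n with h | rfl | h
    · rw [if_neg h.not_ge, if_pos h.le, mul_one]
    · simp
    · rw [if_pos h.le, if_neg h.not_ge, ← zpow_add₀ (by norm_num)]
      simp
  simp only [wignerSmallD]
  rw [hsign, show (n - k).natAbs = (k - n).natAbs by lia, add_comm n]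
  ring

lemma wignerSmallD_neg_neg (l : ℕ) (k n : ℤ) (θ : ℝ) :
    wignerSmallD l (-k) (-n) θ = (-1) ^ (k - n) * wignerSmallD l k n θ := by
  rw [← wignerSmallD_swap]
  simp only [wignerSmallD]
  rw [show (-k - -n).natAbs = (n - k).natAbs by lia, show (-k + -n).natAbs = (n + k).natAbs by lia,
    show -n - -k = k - n by ring]
  simp only [neg_le_neg_iff]

lemma wignerSmallD_eq_rotMatrix_of_le_of_add_nonpos {l : ℕ} {k n : ℤ} (hk : |k| ≤ l)
    (hn : |n| ≤ l) (hnk : n ≤ k) (hkn : k + n ≤ 0) (θ : ℝ) :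
    wignerSmallD l k n θ = rotMatrix (cos (θ / 2)) (sin (θ / 2)) l k n := by
  rw [abs_le] at hk hn
  obtain ⟨ξ, hξ⟩ := Int.eq_ofNat_of_zero_le (sub_nonneg.mpr hnk)
  obtain ⟨lam, hlam⟩ := Int.eq_ofNat_of_zero_le (neg_nonneg.mpr hkn)
  obtain ⟨α, hα⟩ := Int.eq_ofNat_of_zero_le (show 0 ≤ l + n by lia)
  have hsign : (if k ≤ n then (1 : ℝ) else (-1) ^ (n - k)) = (-1) ^ ξ := by
    rw [show n - k = -ξ by lia, zpow_neg, zpow_natCast, ← inv_pow, inv_neg_one]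
    split_ifs with h
    · simp [show ξ = 0 by lia]
    · rfl
  simp only [wignerSmallD]
  rw [rotMatrix_eq _ _ (N := 2 * α + ξ + lam) (i := α + ξ) (j := α) (by lia) (by lia) (by lia),
    show 2 * α + ξ + lam - (α + ξ) = α + lam by lia, linPowCoeff_half_angle_eq_jacobiPoly,
    sqrt_choose_div_sqrt_choose (by lia) (by lia), show 2 * α + ξ + lam - α = α + ξ + lam by lia,
    show 2 * α + ξ + lam - (α + ξ) = α + lam by lia, hsign, neg_pow (sin _),
    show (k - n).natAbs = ξ by lia, show (k + n).natAbs = lam by lia,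
    show l - (ξ + lam) / 2 = α by lia]
  ring

lemma wignerSmallD_eq_rotMatrix {l : ℕ} {k n : ℤ} (hk : |k| ≤ l) (hn : |n| ≤ l) (θ : ℝ) :
    wignerSmallD l k n θ = rotMatrix (cos (θ / 2)) (sin (θ / 2)) l k n := by
  wlog hkn : k + n ≤ 0 generalizing k n
  · rw [← neg_neg k, ← neg_neg n, wignerSmallD_neg_neg, this (by rwa [abs_neg]) (by rwa [abs_neg])
      (by lia), ← rotMatrix_neg_neg _ _ (by rwa [abs_neg]) (by rwa [abs_neg])]
  rcases le_total n k with h | h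
  · exact wignerSmallD_eq_rotMatrix_of_le_of_add_nonpos hk hn h hkn θ
  · rw [wignerSmallD_swap, rotMatrix_swap _ _ hn hk,
      wignerSmallD_eq_rotMatrix_of_le_of_add_nonpos hn hk h (by lia)]

lemma sqrt_mul_assocLegendre_cos {l : ℕ} {k : ℤ} (hk : |k| ≤ l) {θ : ℝ}
    (hθ : θ ∈ Set.Icc 0 Real.pi) :
    √(((l - k).toNat.factorial : ℝ) / (l + k).toNat.factorial) * assocLegendre l k (cos θ) =
      (-1) ^ k * wignerSmallD l 0 k θ := by
  have hl : |(0 : ℤ)| ≤ l := by simp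
  rw [wignerSmallD_eq_rotMatrix hl hk]
  rw [abs_le] at hk
  obtain ⟨i, hi⟩ := Int.eq_ofNat_of_zero_le (show 0 ≤ l + k by lia)
  have hsqrt : √(((2 * l - i).factorial : ℝ) / i.factorial) * (i.factorial / l.factorial) =
      √((i.factorial * (2 * l - i).factorial) / (l.factorial * l.factorial)) := by
    rw [← Real.sqrt_sq (by positivity : (0 : ℝ) ≤ i.factorial / l.factorial),
      ← Real.sqrt_mul (by positivity)]
    congr 1
    field_simp
  rw [assocLegendre_cos hi.symm hθ, rotMatrix_eq _ _ (i := l) (j := i) rfl (by lia) (by lia),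
    sqrt_choose_div_sqrt_choose (by lia) (by lia), show 2 * l - l = l by lia, ← hsqrt,
    show (l - k).toNat = 2 * l - i by lia, show (l + k).toNat = i by lia]
  ring

lemma sqrt_two_pi_mul_sqrt_div_eight_pi_sq (x : ℝ) :
    √(2 * Real.pi) * √(x / (8 * Real.pi ^ 2)) = √(x / (4 * Real.pi)) := by
  rw [← Real.sqrt_mul (by positivity)]
  congr 1
  field_simp
  ring

lemma sphericalHarmonic_eq_wignerD {l : ℕ} {k : ℤ} (hk : |k| ≤ l) (θ φ : ℝ) :
    sphericalHarmonic l k θ φ =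
      (-1) ^ k * √(2 * Real.pi) * wignerD l 0 k (Real.arccos (cos θ)) 0 (-φ) := by
  have hcos := Real.cos_arccos (Real.neg_one_le_cos θ) (Real.cos_le_one θ)
  have hmem : Real.arccos (cos θ) ∈ Set.Icc 0 Real.pi :=
    ⟨Real.arccos_nonneg _, Real.arccos_le_pi _⟩
  rw [sphericalHarmonic, wignerD, Real.sqrt_mul (by positivity), mul_assoc, ← hcos,
    sqrt_mul_assocLegendre_cos hk hmem, hcos, ← sqrt_two_pi_mul_sqrt_div_eight_pi_sq]
  push_cast
  simp only [mul_zero, neg_zero, Complex.exp_zero, mul_neg, neg_neg]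
  ring

end Rodrigues

section Products

lemma wignerSmallD_mul_wignerSmallD {l₁ l₂ : ℕ} {k₁ k₂ n₁ n₂ : ℤ} (hk₁ : |k₁| ≤ l₁)
    (hk₂ : |k₂| ≤ l₂) (hn₁ : |n₁| ≤ l₁) (hn₂ : |n₂| ≤ l₂) (θ : ℝ) :
    wignerSmallD l₁ k₁ n₁ θ * wignerSmallD l₂ k₂ n₂ θ =
      ∑ l ∈ Finset.Icc ((l₂ : ℤ) - l₁).natAbs (l₁ + l₂),
        (-1) ^ (k₁ + k₂ + n₁ + n₂) * (2 * l + 1) *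
          wigner3j l₁ l₂ l k₁ k₂ (-(k₁ + k₂)) * wigner3j l₁ l₂ l n₁ n₂ (-(n₁ + n₂)) *
          wignerSmallD l (k₁ + k₂) (n₁ + n₂) θ := by
  rw [wignerSmallD_eq_rotMatrix hk₁ hn₁, wignerSmallD_eq_rotMatrix hk₂ hn₂,
    rotMatrix_mul_rotMatrix (Real.cos_sq_add_sin_sq _) hk₁ hk₂ hn₁ hn₂]
  refine Finset.sum_congr rfl fun l _ => ?_
  by_cases hk : |k₁ + k₂| ≤ l
  · by_cases hn : |n₁ + n₂| ≤ l
    · rw [wignerSmallD_eq_rotMatrix hk hn]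
    · rw [wigner3j_eq_zero_of_abs_lt (k₁ := n₁) (k₃ := -(n₁ + n₂)) (by rw [abs_neg]; lia)]
      simp only [mul_zero, zero_mul]
  · rw [wigner3j_eq_zero_of_abs_lt (k₁ := k₁) (k₃ := -(k₁ + k₂)) (by rw [abs_neg]; lia)]
    simp only [mul_zero, zero_mul]

lemma sqrt_div_mul_sqrt_div_mul {a b c d : ℝ} (ha : 0 ≤ a) (hb : 0 ≤ b) (hc : 0 ≤ c)
    (hd : 0 ≤ d) : √(a / d) * √(b / d) * c = √(a * b * c / d) * √(c / d) := by
  rw [← Real.sqrt_mul (by positivity), ← Real.sqrt_mul (by positivity),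
    show a * b * c / d * (c / d) = a / d * (b / d) * c ^ 2 by ring,
    Real.sqrt_mul (by positivity) (c ^ 2), Real.sqrt_sq hc]

lemma wignerD_mul_wignerD {l₁ l₂ : ℕ} {k₁ k₂ n₁ n₂ : ℤ} (hk₁ : |k₁| ≤ l₁)
    (hk₂ : |k₂| ≤ l₂) (hn₁ : |n₁| ≤ l₁) (hn₂ : |n₂| ≤ l₂) (θ φ χ : ℝ) :
    wignerD l₁ k₁ n₁ θ φ χ * wignerD l₂ k₂ n₂ θ φ χ =
      (-1) ^ (k₁ + k₂ + n₁ + n₂) * ∑ l ∈ Finset.Icc ((l₂ : ℤ) - l₁).natAbs (l₁ + l₂),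
        (√((2 * l₁ + 1) * (2 * l₂ + 1) * (2 * l + 1) / (8 * Real.pi ^ 2)) : ℂ) *
          wigner3j l₁ l₂ l n₁ n₂ (-(n₁ + n₂)) * wigner3j l₁ l₂ l k₁ k₂ (-(k₁ + k₂)) *
          wignerD l (k₁ + k₂) (n₁ + n₂) θ φ χ := by
  have hexp (a b : ℤ) (x : ℝ) : Complex.exp (-(Complex.I * (a + b : ℤ) * x)) =
      Complex.exp (-(Complex.I * a * x)) * Complex.exp (-(Complex.I * b * x)) := by
    rw [← Complex.exp_add]
    push_cast
    ring_nf
  have hsmall := congrArg Complex.ofReal (wignerSmallD_mul_wignerSmallD hk₁ hk₂ hn₁ hn₂ θ)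
  push_cast at hsmall
  simp only [wignerD, hexp]
  trans √((2 * l₁ + 1) / (8 * Real.pi ^ 2)) * √((2 * l₂ + 1) / (8 * Real.pi ^ 2)) *
    (Complex.exp (-(Complex.I * k₁ * φ)) * Complex.exp (-(Complex.I * k₂ * φ))) *
    (Complex.exp (-(Complex.I * n₁ * χ)) * Complex.exp (-(Complex.I * n₂ * χ))) *
    (wignerSmallD l₁ k₁ n₁ θ * wignerSmallD l₂ k₂ n₂ θ)
  · ring
  rw [hsmall, Finset.mul_sum, Finset.mul_sum]
  refine Finset.sum_congr rfl fun l _ => ?_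
  have hnorm := congrArg Complex.ofReal (sqrt_div_mul_sqrt_div_mul (a := 2 * l₁ + 1)
    (b := 2 * l₂ + 1) (c := 2 * l + 1) (d := 8 * Real.pi ^ 2) (by positivity) (by positivity)
    (by positivity) (by positivity))
  push_cast at hnorm
  linear_combination ((-1) ^ (k₁ + k₂ + n₁ + n₂) *
    (Complex.exp (-(Complex.I * k₁ * φ)) * Complex.exp (-(Complex.I * k₂ * φ))) *
    (Complex.exp (-(Complex.I * n₁ * χ)) * Complex.exp (-(Complex.I * n₂ * χ))) *
    wigner3j l₁ l₂ l n₁ n₂ (-(n₁ + n₂)) * wigner3j l₁ l₂ l k₁ k₂ (-(k₁ + k₂)) *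
    wignerSmallD l (k₁ + k₂) (n₁ + n₂) θ) * hnorm

lemma conj_wignerD (l : ℕ) (k n : ℤ) (θ φ χ : ℝ) :
    (starRingEnd ℂ) (wignerD l k n θ φ χ) = (-1) ^ (k - n) * wignerD l (-k) (-n) θ φ χ := by
  have hsign : ((-1 : ℂ) ^ (k - n)) * (-1) ^ (k - n) = 1 := by
    rw [← mul_zpow, neg_one_mul, neg_neg, one_zpow]
  simp only [wignerD, map_mul, Complex.conj_ofReal, ← Complex.exp_conj, map_neg, Complex.conj_I,
    map_intCast, wignerSmallD_neg_neg, Int.cast_neg, neg_mul, mul_neg, Complex.ofReal_mul,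
    Complex.ofReal_zpow, Complex.ofReal_neg, Complex.ofReal_one]
  linear_combination (-(√((2 * l + 1) / (8 * Real.pi ^ 2)) *
    Complex.exp (-(-(Complex.I * k * φ))) * wignerSmallD l k n θ *
    Complex.exp (-(-(Complex.I * n * χ))))) * hsign

lemma conj_wignerD_mul_wignerD {l₁ l₂ : ℕ} {k₁ k₂ n₁ n₂ : ℤ} (hk₁ : |k₁| ≤ l₁)
    (hk₂ : |k₂| ≤ l₂) (hn₁ : |n₁| ≤ l₁) (hn₂ : |n₂| ≤ l₂) (θ φ χ : ℝ) :
    (starRingEnd ℂ) (wignerD l₁ k₁ n₁ θ φ χ) * wignerD l₂ k₂ n₂ θ φ χ =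
      (-1) ^ (k₂ + n₂) * ∑ l ∈ Finset.Icc ((l₂ : ℤ) - l₁).natAbs (l₁ + l₂),
        (√((2 * l₁ + 1) * (2 * l₂ + 1) * (2 * l + 1) / (8 * Real.pi ^ 2)) : ℂ) *
          wigner3j l₁ l₂ l (-n₁) n₂ (-(n₂ - n₁)) * wigner3j l₁ l₂ l (-k₁) k₂ (-(k₂ - k₁)) *
          wignerD l (k₂ - k₁) (n₂ - n₁) θ φ χ := by
  have hsign : (-1 : ℂ) ^ (k₁ - n₁) * (-1) ^ (-k₁ + k₂ + -n₁ + n₂) = (-1) ^ (k₂ + n₂) := by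
    rw [← zpow_add₀ (by simp), show k₁ - n₁ + (-k₁ + k₂ + -n₁ + n₂) = 2 * -n₁ + (k₂ + n₂) by ring,
      zpow_add₀ (by simp), (even_two_mul _).neg_one_zpow, one_mul]
  rw [conj_wignerD, mul_assoc, wignerD_mul_wignerD (by rwa [abs_neg]) hk₂ (by rwa [abs_neg]) hn₂,
    ← mul_assoc, hsign, neg_add_eq_sub, neg_add_eq_sub]

lemma conj_sphericalHarmonic {l : ℕ} {k : ℤ} (hk : |k| ≤ l) (θ φ : ℝ) :
    (starRingEnd ℂ) (sphericalHarmonic l k θ φ) = (-1) ^ k * sphericalHarmonic l (-k) θ φ := by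
  rw [sphericalHarmonic_eq_wignerD hk, sphericalHarmonic_eq_wignerD (by rwa [abs_neg]), map_mul,
    conj_wignerD]
  simp only [map_mul, map_zpow₀, map_neg, map_one, Complex.conj_ofReal, zero_sub, neg_zero]
  ring

lemma conj_sphericalHarmonic_mul_sphericalHarmonic {l₁ l₂ : ℕ} {k₁ k₂ : ℤ} (hk₁ : |k₁| ≤ l₁)
    (hk₂ : |k₂| ≤ l₂) (θ φ : ℝ) :
    (starRingEnd ℂ) (sphericalHarmonic l₁ k₁ θ φ) * sphericalHarmonic l₂ k₂ θ φ =
      (-1) ^ k₂ * ∑ l ∈ Finset.Icc ((l₁ : ℤ) - l₂).natAbs (l₁ + l₂),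
        (√((2 * l₁ + 1) * (2 * l₂ + 1) * (2 * l + 1) / (4 * Real.pi)) : ℂ) *
          wigner3j l₁ l₂ l 0 0 0 * wigner3j l₁ l₂ l (-k₁) k₂ (-(k₂ - k₁)) *
          sphericalHarmonic l (k₂ - k₁) θ φ := by
  have hsign : (-1 : ℂ) ^ k₁ * (-1) ^ k₂ = (-1) ^ (k₂ - k₁) := by
    rw [zpow_sub₀ (by simp), div_eq_mul_inv, ← inv_zpow, inv_neg_one, mul_comm]
  have hD := conj_wignerD_mul_wignerD (l₁ := l₁) (l₂ := l₂) (k₁ := 0) (k₂ := 0) (by simp) (by simp)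
    hk₁ hk₂ (Real.arccos (Real.cos θ)) 0 (-φ)
  simp only [sub_zero, neg_zero, zero_add] at hD
  rw [sphericalHarmonic_eq_wignerD hk₁, sphericalHarmonic_eq_wignerD hk₂, map_mul]
  simp only [map_mul, map_zpow₀, map_neg, map_one, Complex.conj_ofReal]
  trans (√(2 * Real.pi)) ^ 2 * (-1) ^ (k₂ - k₁) *
    ((starRingEnd ℂ) (wignerD l₁ 0 k₁ (Real.arccos (Real.cos θ)) 0 (-φ)) *
      wignerD l₂ 0 k₂ (Real.arccos (Real.cos θ)) 0 (-φ))
  · rw [← hsign]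
    ring
  rw [hD, ← neg_sub (l₁ : ℤ), Int.natAbs_neg, mul_left_comm, Finset.mul_sum]
  congr 1
  refine Finset.sum_congr rfl fun l _ => ?_
  by_cases hk : |k₂ - k₁| ≤ l
  · rw [sphericalHarmonic_eq_wignerD hk, ← sqrt_two_pi_mul_sqrt_div_eight_pi_sq]
    push_cast
    ring
  · rw [wigner3j_eq_zero_of_abs_lt (k₁ := -k₁) (k₃ := -(k₂ - k₁)) (by rw [abs_neg]; lia)]
    simp only [Complex.ofReal_zero, mul_zero, zero_mul]

lemma sum_mul_sum_comm {ι κ R : Type*} [CommSemiring R] (s : Finset ι) (t : Finset κ) (a : R)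
    (w : κ → R) (f : κ → ι → R) :
    ∑ p ∈ s, a * ∑ l ∈ t, w l * f l p = a * ∑ l ∈ t, w l * ∑ p ∈ s, f l p := by
  simp only [← Finset.mul_sum, Finset.sum_comm (s := s)]

end Products

theorem proposition1_general (m : ℕ) (θ φ : Fin m → ℝ) (l₁ l₂ : ℕ) (k₁ k₂ : ℤ)
    (hk₁ : |k₁| ≤ l₁) (hk₂ : |k₂| ≤ l₂) :
    (∀ (χ : Fin m → ℝ) (n₁ n₂ : ℤ), |n₁| ≤ l₁ → |n₂| ≤ l₂ →
      ∑ p, (starRingEnd ℂ) (wignerD l₁ k₁ n₁ (θ p) (φ p) (χ p)) *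
          wignerD l₂ k₂ n₂ (θ p) (φ p) (χ p) =
        (-1 : ℂ) ^ (k₂ + n₂) *
          ∑ l ∈ Finset.Icc ((l₂ : ℤ) - l₁).natAbs (l₁ + l₂),
            (Real.sqrt ((2 * l₁ + 1) * (2 * l₂ + 1) * (2 * l + 1) / (8 * Real.pi ^ 2)) : ℂ) *
            (wigner3j l₁ l₂ l (-n₁) n₂ (-(n₂ - n₁)) : ℂ) *
            (wigner3j l₁ l₂ l (-k₁) k₂ (-(k₂ - k₁)) : ℂ) *
            ∑ p, wignerD l (k₂ - k₁) (n₂ - n₁) (θ p) (φ p) (χ p)) ∧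
    (∑ p, (starRingEnd ℂ) (sphericalHarmonic l₁ k₁ (θ p) (φ p)) *
          sphericalHarmonic l₂ k₂ (θ p) (φ p) =
        ∑ p, (-1 : ℂ) ^ k₁ * sphericalHarmonic l₁ (-k₁) (θ p) (φ p) *
          sphericalHarmonic l₂ k₂ (θ p) (φ p)) ∧
    (∑ p, (starRingEnd ℂ) (sphericalHarmonic l₁ k₁ (θ p) (φ p)) *
          sphericalHarmonic l₂ k₂ (θ p) (φ p) =
        (-1 : ℂ) ^ k₂ *
          ∑ l ∈ Finset.Icc ((l₁ : ℤ) - l₂).natAbs (l₁ + l₂),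
            (Real.sqrt ((2 * l₁ + 1) * (2 * l₂ + 1) * (2 * l + 1) / (4 * Real.pi)) : ℂ) *
            (wigner3j l₁ l₂ l 0 0 0 : ℂ) *
            (wigner3j l₁ l₂ l (-k₁) k₂ (-(k₂ - k₁)) : ℂ) *
            ∑ p, sphericalHarmonic l (k₂ - k₁) (θ p) (φ p)) := by
  refine ⟨fun χ n₁ n₂ hn₁ hn₂ => ?_, ?_, ?_⟩
  · rw [← sum_mul_sum_comm]
    exact Finset.sum_congr rfl fun p _ => conj_wignerD_mul_wignerD hk₁ hk₂ hn₁ hn₂ _ _ _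
  · exact Finset.sum_congr rfl fun p _ => by rw [conj_sphericalHarmonic hk₁]
  · rw [← sum_mul_sum_comm]
    exact Finset.sum_congr rfl fun p _ =>
      conj_sphericalHarmonic_mul_sphericalHarmonic hk₁ hk₂ _ _

theorem proposition1 (m : ℕ) (θ φ : Fin m → ℝ) (hθ : ∀ p, θ p ∈ Set.Icc 0 Real.pi)
    (l₁ l₂ : ℕ) (k₁ k₂ : ℤ) (hk₁ : |k₁| ≤ l₁) (hk₂ : |k₂| ≤ l₂) :
    (∀ (χ : Fin m → ℝ) (n₁ n₂ : ℤ), |n₁| ≤ l₁ → |n₂| ≤ l₂ →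
      ∑ p, (starRingEnd ℂ) (wignerD l₁ k₁ n₁ (θ p) (φ p) (χ p)) *
          wignerD l₂ k₂ n₂ (θ p) (φ p) (χ p) =
        (-1 : ℂ) ^ (k₂ + n₂) *
          ∑ l ∈ Finset.Icc ((l₂ : ℤ) - l₁).natAbs (l₁ + l₂),
            (Real.sqrt ((2 * l₁ + 1) * (2 * l₂ + 1) * (2 * l + 1) / (8 * Real.pi ^ 2)) : ℂ) *
            (wigner3j l₁ l₂ l (-n₁) n₂ (-(n₂ - n₁)) : ℂ) *
            (wigner3j l₁ l₂ l (-k₁) k₂ (-(k₂ - k₁)) : ℂ) *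
            ∑ p, wignerD l (k₂ - k₁) (n₂ - n₁) (θ p) (φ p) (χ p)) ∧
    (∑ p, (starRingEnd ℂ) (sphericalHarmonic l₁ k₁ (θ p) (φ p)) *
          sphericalHarmonic l₂ k₂ (θ p) (φ p) =
        ∑ p, (-1 : ℂ) ^ k₁ * sphericalHarmonic l₁ (-k₁) (θ p) (φ p) *
          sphericalHarmonic l₂ k₂ (θ p) (φ p)) ∧
    (∑ p, (starRingEnd ℂ) (sphericalHarmonic l₁ k₁ (θ p) (φ p)) *
          sphericalHarmonic l₂ k₂ (θ p) (φ p) =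
        (-1 : ℂ) ^ k₂ *
          ∑ l ∈ Finset.Icc ((l₁ : ℤ) - l₂).natAbs (l₁ + l₂),
            (Real.sqrt ((2 * l₁ + 1) * (2 * l₂ + 1) * (2 * l + 1) / (4 * Real.pi)) : ℂ) *
            (wigner3j l₁ l₂ l 0 0 0 : ℂ) *
            (wigner3j l₁ l₂ l (-k₁) k₂ (-(k₂ - k₁)) : ℂ) *
            ∑ p, sphericalHarmonic l (k₂ - k₁) (θ p) (φ p)) :=
  proposition1_general m θ φ l₁ l₂ k₁ k₂ hk₁ hk₂
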